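/- Fix $\alpha>0$, an integer $k\ge 0$ and pairwise distinct numbers $\tilde u_1,\dots,\tilde u_k\in\mathbb R\setminus\mathbb Z$. For $a>0$ let $\omega_a(x)=e^{-a}a^x/\Gamma(x+1)$ be the Poisson (Charlier) weight. For $N\ge 1$ put $u_i=\tilde u_i+N$ and consider the Christoffel-deformed weight $\omega^k_N(x)=\prod_{i=1}^k(x-u_i)^2\,\omega_{\alpha/N}(x)$. Let $p_n$ ($n\ge 0$) be the monic orthogonal polynomials of the measure $\sum_{x\in\mathbb N}\omega_N^k(x)\delta_x$ on $\mathbb N=\{0,1,2,\dots\}$, let $h_n=\sum_{x\in\mathbb N}p_n(x)^2\omega_N^k(x)$, and let $$K_N^{\alpha/N,k}(x,y)=\sqrt{\omega^k_N(x)\,\omega^k_N(y)}\;\sum_{n=0}^{N-1}\frac{p_n(x)p_n(y)}{h_n}.$$ For every $N\ge1$ the order-$k$ Christoffel deformation of the $N$-th Charlier ensemble with parameter $\alpha/N$ at the points $u_1,\dots,u_k$, that is, the law of $\{x_1,\dots,x_N\}$ under the probability measure on $\mathbb N^N$ proportional to $\prod_{i<j}(x_i-x_j)^2\prod_i\omega_N^k(x_i)$,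 is a determinantal point process on $\mathbb N$ with correlation kernel $K_N^{\alpha/N,k}$. Let $J_\nu(z)=\sum_{m\ge0}\frac{(-1)^m}{m!\,\Gamma(m+\nu+1)}(z/2)^{2m+\nu}$ be the Bessel function of real order $\nu$. The map $\nu\mapsto J_\nu(2\sqrt\alpha)$ is differentiable on $\mathbb R$. Put $L_\nu(2\sqrt\alpha)=\frac{d}{d\nu}J_\nu(2\sqrt\alpha)$. For $p\in\{0,1\}$ and $x\in\mathbb R$ let $A_{k,p}(x)$ be the $(2k+1)\times(2k+1)$ determinant with columns $j=0,\dots,2k$ and rows $$\bigl(J_{\tilde u_i+p-j}(2\sqrt\alpha)\bigr)_j\ (i=1,\dots,k),\qquad \bigl(L_{\tilde u_i+p-j}(2\sqrt\alpha)\bigr)_j\ (i=1,\dots,k),\qquad \bigl(J_{x+p-j}(2\sqrt\alpha)\bigr)_j,$$ and let $C_k$ be the $2k\times2k$ determinant with columns $j=0,\dots,2k-1$ and rows $\bigl(J_{\tilde u_i-j}(2\sqrt\alpha)\bigr)_j$ ($i=1,\dots,k$), $\bigl(L_{\tilde u_i-j}(2\sqrt\alpha)\bigr)_j$ ($i=1,\dots,k$).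 Then $C_k\neq0$, and for all $x,y\in\mathbb R\setminus\{\tilde u_1,\dots,\tilde u_k\}$ with $x\ne y$, $$\lim_{N\to\infty}K_N^{\alpha/N,k}(x+N,y+N)=\frac{\alpha^{\frac{2k+1}{2}}}{C_k^2\prod_{i=1}^k|(x-\tilde u_i)(y-\tilde u_i)|}\;\frac{A_{k,0}(x)A_{k,1}(y)-A_{k,0}(y)A_{k,1}(x)}{x-y},$$ while for all $x\in\mathbb R\setminus\{\tilde u_1,\dots,\tilde u_k\}$, $$\lim_{N\to\infty}K_N^{\alpha/N,k}(x+N,x+N)=\frac{\alpha^{\frac{2k+1}{2}}}{C_k^2\prod_{i=1}^k(x-\tilde u_i)^2}\bigl(A_{k,0}'(x)A_{k,1}(x)-A_{k,0}(x)A_{k,1}'(x)\bigr).$$ For $k=0$ the first limit is the discrete Bessel kernel $\sqrt\alpha\,\dfrac{J_x(2\sqrt\alpha)J_{y+1}(2\sqrt\alpha)-J_y(2\sqrt\alpha)J_{x+1}(2\sqrt\alpha)}{x-y}$. -/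

import Mathlib

open Filter Topology MeasureTheory

noncomputable section

namespace CharlierDeformation

/-! ### Discrete weights on the non-negative integers and their orthogonal polynomials

A weight is given by a function `w : ℝ → ℝ`; only its values at the points of `ℕ` enter the
measure `∑ w(n) δ_n`, the values at other reals are used to evaluate kernels off the lattice. -/

/-- The pairing `∑_{n ∈ ℕ} P(n) Q(n) w(n)` of two real polynomials. -/
def pairing (w : ℝ → ℝ) (P Q : Polynomial ℝ) : ℝ :=
  ∑' n : ℕ, P.eval (n : ℝ) * Q.eval (n : ℝ) * w n

/-- The monic orthogonal polynomials `p_n` of the weight `w`, by the Gram–Schmidt process. -/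
def monicOrthPoly (w : ℝ → ℝ) : ℕ → Polynomial ℝ
  | n => Polynomial.X ^ n - ∑ m : Fin n,
      Polynomial.C (pairing w (Polynomial.X ^ n) (monicOrthPoly w m)
        / pairing w (monicOrthPoly w m) (monicOrthPoly w m)) * monicOrthPoly w m
  termination_by n => n
  decreasing_by all_goals exact m.2

/-- The `N`-th Christoffel–Darboux kernel
`K_N(x,y) = √(w(x) w(y)) ∑_{n < N} p_n(x) p_n(y) / h_n`, where `h_n = ∑ p_n² w`. -/
def cdKernel (w : ℝ → ℝ) (N : ℕ) (x y : ℝ) : ℝ :=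
  √(w x * w y) * ∑ n ∈ Finset.range N,
    (monicOrthPoly w n).eval x * (monicOrthPoly w n).eval y
      / pairing w (monicOrthPoly w n) (monicOrthPoly w n)

/-! ### Orthogonal polynomial ensembles and determinantal point processes on `ℕ` -/

/-- The unnormalised density `∏_{i<j} (x_i - x_j)² ∏_i w(x_i)` of the ensemble. -/
def opeDensity (w : ℝ → ℝ) (N : ℕ) (x : Fin N → ℕ) : ℝ :=
  (∏ i : Fin N, ∏ j ∈ Finset.Ioi i, ((x i : ℝ) - x j) ^ 2) * ∏ i : Fin N, w (x i)

/-- The `N`-th orthogonal polynomial ensemble with weight `w`, as a measure on `ℕ^N`. -/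
def opeMeasure (w : ℝ → ℝ) (N : ℕ) : Measure (Fin N → ℕ) :=
  Measure.sum fun x =>
    ENNReal.ofReal (opeDensity w N x / ∑' y : Fin N → ℕ, opeDensity w N y) • Measure.dirac x

/-- The same ensemble as a point process, that is, as a measure on the space `2^ℕ` of
configurations: the law of `{x_1, …, x_N}`. -/
def opeProcess (w : ℝ → ℝ) (N : ℕ) : Measure (Set ℕ) :=
  (opeMeasure w N).map fun x => Set.range x

/-- `P` is a determinantal point process on `ℕ` with correlation kernel `K`: it is a probability
measure on configurations and `P(A ⊆ X) = det (K(a,b))_{a,b ∈ A}` for each finite `A ⊆ ℕ`. -/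
def IsDeterminantalWithKernel (P : Measure (Set ℕ)) (K : ℕ → ℕ → ℝ) : Prop :=
  IsProbabilityMeasure P ∧
    ∀ A : Finset ℕ, P.real {X : Set ℕ | (A : Set ℕ) ⊆ X}
      = Matrix.det (Matrix.of fun a b : A => K a b)

/-! ### The Charlier (Poisson) weight and Christoffel deformations -/

/-- The Poisson weight `ω_a(x) = e^{-a} a^x / x!`, where `x! = Γ(x+1)` for real `x`. -/
def charlierWeight (a x : ℝ) : ℝ :=
  Real.exp (-a) * a ^ x / Real.Gamma (x + 1)

/-- The Christoffel deformation `∏_j (x - u_j)² w(x)` of order `k` of the weight `w`. -/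
def christoffelWeight {k : ℕ} (w : ℝ → ℝ) (u : Fin k → ℝ) (x : ℝ) : ℝ :=
  (∏ j : Fin k, (x - u j) ^ 2) * w x

/-- The weight of the deformed ensemble: parameter `a = α / N`, deformation points
`u_j + N`. -/
def deformedWeight {k : ℕ} (α : ℝ) (u : Fin k → ℝ) (N : ℕ) : ℝ → ℝ :=
  christoffelWeight (charlierWeight (α / N)) fun j => u j + N

/-! ### Bessel functions and the limit kernel -/

/-- The Bessel function of the first kind `J_ν(z)` of real order `ν`, for `z > 0`:
`∑_m (-1)^m (z/2)^{2m+ν} / (m! Γ(m+ν+1))`. (Mathlib sets `Γ = 0` at the poles and `1 / 0 = 0`,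
so that `1 / Γ` here is the entire function `1 / Γ`.) -/
def besselJ (ν z : ℝ) : ℝ :=
  ∑' m : ℕ, (-1) ^ m / (m.factorial * Real.Gamma (m + ν + 1)) * (z / 2) ^ (2 * m + ν)

/-- The derivative `L_ν(z)` of `J_ν(z)` with respect to the order `ν`. -/
def besselL (ν z : ℝ) : ℝ :=
  deriv (fun μ => besselJ μ z) ν

/-- The `(2k+1) × (2k+1)` determinant `A_{k,p}(x)`; with `j = 0, …, 2k` indexing the columns its
rows are `J_{u_i + p - j}` (`i = 1, …, k`), then `L_{u_i + p - j}` (`i = 1, …, k`), then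
`J_{x + p - j}`, all at `2√α`. -/
def wronskianA {k : ℕ} (α : ℝ) (u : Fin k → ℝ) (p : ℕ) (x : ℝ) : ℝ :=
  Matrix.det (Matrix.of fun i j : Fin (2 * k + 1) =>
    if h : i.val < k then besselJ (u ⟨i.val, h⟩ + p - j.val) (2 * √α)
    else if h' : i.val < 2 * k then besselL (u ⟨i.val - k, by omega⟩ + p - j.val) (2 * √α)
    else besselJ (x + p - j.val) (2 * √α))

/-- The `2k × 2k` determinant `C_k`; with `j = 0, …, 2k-1` indexing the columns its rows are
`J_{u_i - j}` (`i = 1, …, k`), then `L_{u_i - j}` (`i = 1, …, k`), all at `2√α`. -/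
def wronskianC {k : ℕ} (α : ℝ) (u : Fin k → ℝ) : ℝ :=
  Matrix.det (Matrix.of fun i j : Fin (2 * k) =>
    if h : i.val < k then besselJ (u ⟨i.val, h⟩ - j.val) (2 * √α)
    else besselL (u ⟨i.val - k, by omega⟩ - j.val) (2 * √α))

/-- The limit kernel off the diagonal. -/
def limitKernel {k : ℕ} (α : ℝ) (u : Fin k → ℝ) (x y : ℝ) : ℝ :=
  α ^ ((2 * k + 1 : ℝ) / 2) / (wronskianC α u ^ 2 * ∏ i : Fin k, |(x - u i) * (y - u i)|)
    * ((wronskianA α u 0 x * wronskianA α u 1 y - wronskianA α u 0 y * wronskianA α u 1 x)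
      / (x - y))

/-- The limit kernel on the diagonal. -/
def limitKernelDiag {k : ℕ} (α : ℝ) (u : Fin k → ℝ) (x : ℝ) : ℝ :=
  α ^ ((2 * k + 1 : ℝ) / 2) / (wronskianC α u ^ 2 * ∏ i : Fin k, (x - u i) ^ 2)
    * (deriv (wronskianA α u 0) x * wronskianA α u 1 x
      - wronskianA α u 0 x * deriv (wronskianA α u 1) x)

/-- The discrete Bessel kernel (off the diagonal) of the poissonized Plancherel measure. -/
def discreteBesselKernel (α x y : ℝ) : ℝ :=
  √α * ((besselJ x (2 * √α) * besselJ (y + 1) (2 * √α)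
    - besselJ y (2 * √α) * besselJ (x + 1) (2 * √α)) / (x - y))

end CharlierDeformation

end

open CharlierDeformation

/-!
The determinantal property holds for every positive weight `w` on `ℕ` with finite moments. The
density of the ensemble is `det (p_i(x_j))² ∏ w(x_j)`, so Andréief's identity turns the probability
that no particle lies in a finite set `B` into `det (1 - A)`, where `A_{nm}` sums
`p_n p_m w / h_n` over `B`. By `det (1 - ST) = det (1 - TS)` this is `det (1 - K|_B)`, which expands
into the principal minors of `K`; inclusion–exclusion then recovers the correlation functions
(`isDeterminantalWithKernel_of_gap`, `AdmissibleWeight.isDeterminantalWithKernel_ope`).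

For the limit, Christoffel's formula (`AdmissibleWeight.christoffelPoly_eq`) writes
`∏ (X - v_i)²` times a deformed orthogonal polynomial as a bordered determinant, in the values
and derivatives of `2k + 1` consecutive Charlier polynomials at the nodes `v_i`, divided by the
confluent determinant `W_n`. The norms are multiplied by `W_{n+1} / W_n`. With the
Christoffel–Darboux formula, the deformed kernel becomes a commutator of two bordered determinants
divided by `W_N²` (`AdmissibleWeight.cdKernel_christoffelWeight`,
`AdmissibleWeight.cdKernel_christoffelWeight_diag`).

The Charlier polynomial satisfies
`C_m(x + N) / Γ(x + N + 1) = ∑_l binom(m, l) (-α/N)^l / Γ(x + N - m + l + 1)`. For `m = N + d` the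
coefficients tend in `ℓ¹` to `(-α)^l / l!`, which are those of `α^{-ν/2} J_ν(2√α)` at `ν = x - d`.
Since `1/Γ` is entire, such series converge locally uniformly in the complex plane, and values and
derivatives in `x` converge together (`tendsto_gammaSeries`, `tendsto_deriv_gammaSeries`).
Derivatives in `x` of the factors `Γ(x + N + 1)` and `α^{-ν/2}` drop out: at the nodes they add
multiples of the rows of values to the rows of derivatives, and on the diagonal they cancel by
antisymmetry. The remaining powers of `N` cancel by
`Γ(x + N + 1) ∼ N! N^x`.

The determinant `C_k` is, up to a nonzero factor, the limit of the rescaled `W_N`, so it is enough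
to bound these from below (`limitMinor_ne_zero`). Now `W_N / W_0` is the quotient of the partition
functions of the deformed and the undeformed ensemble. The former is at least the contribution of
the configuration `{0, …, N - 1}`, whose probability in the undeformed ensemble is `e^{-α}` for
every `N`. Finally `W_0` is a confluent Vandermonde determinant of the `ũ_i`, independent of `N` and
nonzero.
-/

open Polynomial (X C)

/-! ### Orthogonal polynomials of a weight on `ℕ` -/

/-- A weight is *admissible* if it is positive at all points of `ℕ` and has finite moments. -/
structure AdmissibleWeight (w : ℝ → ℝ) : Prop where
  pos : ∀ n : ℕ, 0 < w n
  summable_pow : ∀ m : ℕ, Summable fun n : ℕ => (n : ℝ) ^ m * w n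

namespace AdmissibleWeight

variable {w : ℝ → ℝ}

lemma summable_eval (hw : AdmissibleWeight w) (P : Polynomial ℝ) :
    Summable fun n : ℕ => P.eval (n : ℝ) * w n := by
  induction P using Polynomial.induction_on' with
  | add p q hp hq => simpa [add_mul] using hp.add hq
  | monomial m a => simpa [mul_assoc] using (hw.summable_pow m).mul_left a

/-- The functional `P ↦ ∑_{n ∈ ℕ} P(n) w(n)`. -/
noncomputable def functional (hw : AdmissibleWeight w) : Polynomial ℝ →ₗ[ℝ] ℝ where
  toFun P := ∑' n : ℕ, P.eval (n : ℝ) * w n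
  map_add' P Q := by
    simp only [Polynomial.eval_add, add_mul]
    exact (hw.summable_eval P).tsum_add (hw.summable_eval Q)
  map_smul' a P := by
    simp only [Polynomial.eval_smul, smul_eq_mul, mul_assoc, RingHom.id_apply]
    exact tsum_mul_left

lemma pairing_eq (hw : AdmissibleWeight w) (P Q : Polynomial ℝ) :
    pairing w P Q = hw.functional (P * Q) := by
  simp [pairing, functional]

lemma functional_sq_pos (hw : AdmissibleWeight w) {P : Polynomial ℝ} (hP : P ≠ 0) :
    0 < hw.functional (P * P) := by
  have hnn (n : ℕ) : 0 ≤ (P * P).eval (n : ℝ) * w n := by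
    rw [Polynomial.eval_mul]
    exact mul_nonneg (mul_self_nonneg _) (hw.pos n).le
  obtain ⟨n, hn⟩ : ∃ n : ℕ, P.eval (n : ℝ) ≠ 0 := by
    by_contra! h
    refine hP (Polynomial.eq_zero_of_infinite_isRoot P ?_)
    exact (Set.infinite_range_of_injective Nat.cast_injective).mono
      (by rintro _ ⟨n, rfl⟩; exact h n)
  refine (hw.summable_eval (P * P)).tsum_pos hnn n ?_
  rw [Polynomial.eval_mul]
  exact mul_pos (mul_self_pos.2 hn) (hw.pos n)

lemma eq_zero_of_functional_sq (hw : AdmissibleWeight w) {P : Polynomial ℝ}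
    (h : hw.functional (P * P) = 0) : P = 0 := by
  by_contra hP
  exact (hw.functional_sq_pos hP).ne' h

lemma monicOrthPoly_monic_natDegree (w : ℝ → ℝ) (n : ℕ) :
    (monicOrthPoly w n).Monic ∧ (monicOrthPoly w n).natDegree = n := by
  induction n using Nat.strong_induction_on with
  | _ n ih =>
    have hdeg : (∑ m : Fin n, C (pairing w (X ^ n) (monicOrthPoly w m)
        / pairing w (monicOrthPoly w m) (monicOrthPoly w m)) * monicOrthPoly w m).degree < n := by
      rw [← Polynomial.mem_degreeLT]
      refine Submodule.sum_mem _ fun m _ => ?_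
      rw [← Polynomial.smul_eq_C_mul]
      refine Submodule.smul_mem _ _ ?_
      rw [Polynomial.mem_degreeLT, Polynomial.degree_eq_natDegree (ih m m.2).1.ne_zero,
        (ih m m.2).2]
      exact_mod_cast m.2
    rw [monicOrthPoly]
    refine ⟨Polynomial.monic_X_pow_sub hdeg, Polynomial.natDegree_eq_of_degree_eq_some ?_⟩
    rw [Polynomial.degree_sub_eq_left_of_degree_lt (by rwa [Polynomial.degree_X_pow]),
      Polynomial.degree_X_pow]

lemma monicOrthPoly_monic (w : ℝ → ℝ) (n : ℕ) : (monicOrthPoly w n).Monic :=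
  (monicOrthPoly_monic_natDegree w n).1

lemma natDegree_monicOrthPoly (w : ℝ → ℝ) (n : ℕ) : (monicOrthPoly w n).natDegree = n :=
  (monicOrthPoly_monic_natDegree w n).2

lemma degree_monicOrthPoly (w : ℝ → ℝ) (n : ℕ) : (monicOrthPoly w n).degree = n := by
  rw [Polynomial.degree_eq_natDegree (monicOrthPoly_monic w n).ne_zero, natDegree_monicOrthPoly]

/-- A polynomial of degree `< d` that is annihilated by a linear functional on a family `p` with
`p m` monic of degree `m` is annihilated by it altogether. -/
lemma map_eq_zero_of_degree_lt {p : ℕ → Polynomial ℝ}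
    (hp : ∀ n, (p n).Monic) (hd : ∀ n, (p n).natDegree = n) (l : Polynomial ℝ →ₗ[ℝ] ℝ) {d : ℕ}
    (h : ∀ m < d, l (p m) = 0) {Q : Polynomial ℝ} (hQ : Q.degree < d) : l Q = 0 := by
  induction d generalizing Q with
  | zero => simp_all
  | succ d ih =>
    have hpd : (p d).degree = d := by
      rw [Polynomial.degree_eq_natDegree (hp d).ne_zero, hd]
    have hlt : (Q - C (Q.coeff d) * p d).degree < d := by
      rw [Polynomial.degree_lt_iff_coeff_zero]
      intro m hm
      rcases hm.eq_or_lt with rfl | hm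
      · have : (p d).coeff d = 1 := by
          have := (hp d).coeff_natDegree
          rwa [hd] at this
        simp [this]
      · have h1 : Q.coeff m = 0 :=
          Polynomial.coeff_eq_zero_of_degree_lt (hQ.trans_le (by exact_mod_cast hm))
        have h2 : (p d).coeff m = 0 :=
          Polynomial.coeff_eq_zero_of_natDegree_lt (by rw [hd]; exact hm)
        simp [h1, h2]
    have := ih (fun m hm => h m (hm.trans d.lt_succ_self)) hlt
    rw [← Polynomial.smul_eq_C_mul, map_sub, map_smul, h d d.lt_succ_self] at this
    simpa using this

lemma functional_monicOrthPoly_mul_lower (hw : AdmissibleWeight w) {m n : ℕ} (hmn : m < n) :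
    hw.functional (monicOrthPoly w n * monicOrthPoly w m) = 0 := by
  induction n using Nat.strong_induction_on generalizing m with
  | _ n ih =>
    have key : ∀ l : Fin n, l ≠ ⟨m, hmn⟩ →
        hw.functional (monicOrthPoly w l * monicOrthPoly w m) = 0 := by
      intro l hl
      rcases lt_or_gt_of_ne (fun h => hl (Fin.ext h) : l.val ≠ m) with h | h
      · rw [mul_comm]; exact ih m hmn h
      · exact ih l l.2 h
    have hne : hw.functional (monicOrthPoly w m * monicOrthPoly w m) ≠ 0 :=
      (hw.functional_sq_pos (monicOrthPoly_monic w m).ne_zero).ne'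
    conv_lhs => rw [monicOrthPoly]
    simp only [hw.pairing_eq, sub_mul, Finset.sum_mul, map_sub, map_sum,
      ← Polynomial.smul_eq_C_mul]
    simp only [smul_mul_assoc, map_smul, smul_eq_mul]
    rw [Finset.sum_eq_single ⟨m, hmn⟩ (fun l _ hl => by rw [key l hl, mul_zero]) (by simp)]
    rw [div_mul_cancel₀ _ hne, sub_self]

lemma pairing_monicOrthPoly_of_ne (hw : AdmissibleWeight w) {m n : ℕ} (hmn : m ≠ n) :
    pairing w (monicOrthPoly w m) (monicOrthPoly w n) = 0 := by
  rw [hw.pairing_eq]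
  rcases lt_or_gt_of_ne hmn with h | h
  · rw [mul_comm, hw.functional_monicOrthPoly_mul_lower h]
  · exact hw.functional_monicOrthPoly_mul_lower h

lemma functional_monicOrthPoly_mul (hw : AdmissibleWeight w) {n : ℕ} {Q : Polynomial ℝ}
    (hQ : Q.degree < n) : hw.functional (monicOrthPoly w n * Q) = 0 :=
  map_eq_zero_of_degree_lt (monicOrthPoly_monic w) (natDegree_monicOrthPoly w)
    (hw.functional ∘ₗ LinearMap.mulLeft ℝ (monicOrthPoly w n))
    (fun _ hm => hw.functional_monicOrthPoly_mul_lower hm) hQ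

lemma eq_zero_of_orthogonal (hw : AdmissibleWeight w) {d : ℕ} {r : Polynomial ℝ}
    (hr : r.degree < d) (h : ∀ m < d, hw.functional (r * monicOrthPoly w m) = 0) : r = 0 :=
  hw.eq_zero_of_functional_sq <|
    map_eq_zero_of_degree_lt (monicOrthPoly_monic w) (natDegree_monicOrthPoly w)
      (hw.functional ∘ₗ LinearMap.mulLeft ℝ r) h hr

lemma degree_sub_lt_of_monic {p q : Polynomial ℝ} {n : ℕ} (hp : p.Monic) (hpn : p.natDegree = n)
    (hq : q.Monic) (hqn : q.natDegree = n) : (p - q).degree < n := by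
  have hd : p.degree = n := by rw [Polynomial.degree_eq_natDegree hp.ne_zero, hpn]
  have hd' : q.degree = n := by rw [Polynomial.degree_eq_natDegree hq.ne_zero, hqn]
  rw [← hd]
  exact Polynomial.degree_sub_lt_left (hd.trans hd'.symm) hp.ne_zero
    (by rw [hp.leadingCoeff, hq.leadingCoeff])

/-- The monic orthogonal polynomials are characterised by orthogonality. -/
lemma eq_monicOrthPoly (hw : AdmissibleWeight w) {n : ℕ} {q : Polynomial ℝ} (hq : q.Monic)
    (hn : q.natDegree = n) (h : ∀ Q : Polynomial ℝ, Q.degree < n → hw.functional (q * Q) = 0) :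
    q = monicOrthPoly w n := by
  have hlt : (q - monicOrthPoly w n).degree < n :=
    degree_sub_lt_of_monic hq hn (monicOrthPoly_monic w n) (natDegree_monicOrthPoly w n)
  refine sub_eq_zero.1 (hw.eq_zero_of_functional_sq ?_)
  rw [sub_mul, map_sub, h _ hlt, hw.functional_monicOrthPoly_mul hlt, sub_zero]

lemma pairing_monicOrthPoly_pos (hw : AdmissibleWeight w) (n : ℕ) :
    0 < pairing w (monicOrthPoly w n) (monicOrthPoly w n) := by
  rw [hw.pairing_eq]
  exact hw.functional_sq_pos (monicOrthPoly_monic w n).ne_zero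

/-- The squared norm `h_n` is the pairing of `p_n` with any monic polynomial of degree `n`. -/
lemma functional_monicOrthPoly_mul_monic (hw : AdmissibleWeight w) {n : ℕ} {q : Polynomial ℝ}
    (hq : q.Monic) (hn : q.natDegree = n) :
    hw.functional (monicOrthPoly w n * q) = pairing w (monicOrthPoly w n) (monicOrthPoly w n) := by
  rw [hw.pairing_eq, ← sub_eq_zero, ← map_sub, ← mul_sub]
  exact hw.functional_monicOrthPoly_mul
    (degree_sub_lt_of_monic hq hn (monicOrthPoly_monic w n) (natDegree_monicOrthPoly w n))

lemma monic_X_mul_monicOrthPoly (w : ℝ → ℝ) (n : ℕ) : (X * monicOrthPoly w n).Monic ∧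
    (X * monicOrthPoly w n).natDegree = n + 1 := by
  refine ⟨Polynomial.monic_X.mul (monicOrthPoly_monic w n), ?_⟩
  rw [Polynomial.natDegree_X_mul (monicOrthPoly_monic w n).ne_zero, natDegree_monicOrthPoly]

/-- The three-term recurrence `x p_{n+1} = p_{n+2} + b p_{n+1} + (h_{n+1} / h_n) p_n`. -/
lemma exists_three_term_recurrence (hw : AdmissibleWeight w) (n : ℕ) : ∃ b : ℝ,
    X * monicOrthPoly w (n + 1) = monicOrthPoly w (n + 2) + b • monicOrthPoly w (n + 1)
      + (pairing w (monicOrthPoly w (n + 1)) (monicOrthPoly w (n + 1))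
        / pairing w (monicOrthPoly w n) (monicOrthPoly w n)) • monicOrthPoly w n := by
  set p := monicOrthPoly w with hp
  set h : ℕ → ℝ := fun n => pairing w (p n) (p n) with hh
  have hpos : ∀ n, h n ≠ 0 := fun n => (hw.pairing_monicOrthPoly_pos n).ne'
  have hpp : ∀ n, hw.functional (p n * p n) = h n := fun n => (hw.pairing_eq _ _).symm
  have horth : ∀ m n, m ≠ n → hw.functional (p m * p n) = 0 := by
    intro m n hmn
    rw [← hw.pairing_eq]
    exact hw.pairing_monicOrthPoly_of_ne hmn
  refine ⟨hw.functional (X * p (n + 1) * p (n + 1)) / h (n + 1), ?_⟩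
  -- The difference of the two sides has degree `< n + 2` and is orthogonal to `p_0, …, p_{n+1}`.
  rw [← sub_eq_zero]
  have hmem : ∀ m d : ℕ, m < d → (p m).degree < d := fun m d hmd => by
    rw [hp, degree_monicOrthPoly]; exact_mod_cast hmd
  refine hw.eq_zero_of_orthogonal (d := n + 2) ?_ fun m hm => ?_
  · rw [← Polynomial.mem_degreeLT, ← sub_sub, ← sub_sub]
    refine Submodule.sub_mem _ (Submodule.sub_mem _ ?_ (Submodule.smul_mem _ _ ?_))
      (Submodule.smul_mem _ _ ?_)
    · rw [Polynomial.mem_degreeLT]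
      exact degree_sub_lt_of_monic (monic_X_mul_monicOrthPoly w _).1
        (monic_X_mul_monicOrthPoly w _).2 (monicOrthPoly_monic w _) (natDegree_monicOrthPoly w _)
    · exact Polynomial.mem_degreeLT.2 (hmem _ _ (by omega))
    · exact Polynomial.mem_degreeLT.2 (hmem _ _ (by omega))
  · change hw.functional (_ * p m) = 0
    simp only [sub_mul, add_mul, map_sub, map_add, smul_mul_assoc, map_smul, smul_eq_mul]
    rw [horth (n + 2) m (by omega)]
    rcases Nat.lt_succ_iff_lt_or_eq.1 hm with hm' | rfl
    · rw [horth (n + 1) m (by omega)]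
      have hcomm : X * p (n + 1) * p m = p (n + 1) * (X * p m) := by ring
      rw [hcomm]
      rcases Nat.lt_succ_iff_lt_or_eq.1 hm' with hm'' | rfl
      · rw [horth n m (by omega), hw.functional_monicOrthPoly_mul]
        · simp
        · rw [Polynomial.degree_eq_natDegree (monic_X_mul_monicOrthPoly w _).1.ne_zero,
            (monic_X_mul_monicOrthPoly w _).2]
          exact_mod_cast (by omega : m + 1 < n + 1)
      · rw [hw.functional_monicOrthPoly_mul_monic (monic_X_mul_monicOrthPoly w _).1
          (monic_X_mul_monicOrthPoly w _).2, hpp]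
        change h (m + 1) - (0 + _ * 0 + h (m + 1) / h m * h m) = 0
        rw [div_mul_cancel₀ _ (hpos m)]; ring
    · rw [horth n (n + 1) (by omega), hpp, div_mul_cancel₀ _ (hpos _)]
      ring

/-- The Christoffel–Darboux formula. -/
lemma christoffel_darboux (hw : AdmissibleWeight w) (N : ℕ) (x y : ℝ) :
    (x - y) * ∑ n ∈ Finset.range (N + 1), (monicOrthPoly w n).eval x * (monicOrthPoly w n).eval y
      / pairing w (monicOrthPoly w n) (monicOrthPoly w n)
    = ((monicOrthPoly w (N + 1)).eval x * (monicOrthPoly w N).eval y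
      - (monicOrthPoly w N).eval x * (monicOrthPoly w (N + 1)).eval y)
        / pairing w (monicOrthPoly w N) (monicOrthPoly w N) := by
  have hpos : ∀ n, pairing w (monicOrthPoly w n) (monicOrthPoly w n) ≠ 0 :=
    fun n => (hw.pairing_monicOrthPoly_pos n).ne'
  induction N with
  | zero =>
    have h0 : monicOrthPoly w 0 = 1 :=
      Polynomial.eq_one_of_monic_natDegree_zero (monicOrthPoly_monic w 0)
        (natDegree_monicOrthPoly w 0)
    obtain ⟨b, hb⟩ : ∃ b, monicOrthPoly w 1 = X + C b := by
      refine ⟨(monicOrthPoly w 1).coeff 0, ?_⟩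
      have := Polynomial.eq_X_add_C_of_natDegree_le_one (natDegree_monicOrthPoly w 1).le
      have h1 := (monicOrthPoly_monic w 1).coeff_natDegree
      rw [natDegree_monicOrthPoly] at h1
      rw [h1] at this
      simpa using this
    simp [h0, hb]
    ring
  | succ N ih =>
    obtain ⟨b, hb⟩ := hw.exists_three_term_recurrence N
    have hx := congrArg (Polynomial.eval x) hb
    have hy := congrArg (Polynomial.eval y) hb
    simp only [Polynomial.eval_mul, Polynomial.eval_X, Polynomial.eval_add, Polynomial.eval_smul,
      smul_eq_mul] at hx hy
    rw [Finset.sum_range_succ, mul_add, ih]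
    have h1 := hpos N
    have h2 := hpos (N + 1)
    set h := pairing w (monicOrthPoly w N) (monicOrthPoly w N)
    set h' := pairing w (monicOrthPoly w (N + 1)) (monicOrthPoly w (N + 1))
    rw [show N + 1 + 1 = N + 2 from rfl]
    have hx' : (monicOrthPoly w (N + 2)).eval x = x * (monicOrthPoly w (N + 1)).eval x
        - b * (monicOrthPoly w (N + 1)).eval x - h' / h * (monicOrthPoly w N).eval x := by
      linarith
    have hy' : (monicOrthPoly w (N + 2)).eval y = y * (monicOrthPoly w (N + 1)).eval y
        - b * (monicOrthPoly w (N + 1)).eval y - h' / h * (monicOrthPoly w N).eval y := by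
      linarith
    rw [hx', hy']
    field_simp
    ring

/-- The confluent form of the Christoffel–Darboux formula. -/
lemma christoffel_darboux_diag (hw : AdmissibleWeight w) (N : ℕ) (x : ℝ) :
    ∑ n ∈ Finset.range (N + 1), (monicOrthPoly w n).eval x * (monicOrthPoly w n).eval x
      / pairing w (monicOrthPoly w n) (monicOrthPoly w n)
    = ((monicOrthPoly w (N + 1)).derivative.eval x * (monicOrthPoly w N).eval x
      - (monicOrthPoly w N).derivative.eval x * (monicOrthPoly w (N + 1)).eval x)
        / pairing w (monicOrthPoly w N) (monicOrthPoly w N) := by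
  -- The Christoffel–Darboux formula as an identity of polynomials in its first argument, to be
  -- differentiated at `x`.
  have key : (X - C x) * ∑ n ∈ Finset.range (N + 1),
      C ((monicOrthPoly w n).eval x / pairing w (monicOrthPoly w n) (monicOrthPoly w n))
        * monicOrthPoly w n
      = C (1 / pairing w (monicOrthPoly w N) (monicOrthPoly w N))
        * (C ((monicOrthPoly w N).eval x) * monicOrthPoly w (N + 1)
          - C ((monicOrthPoly w (N + 1)).eval x) * monicOrthPoly w N) := by
    refine Polynomial.funext fun z => ?_
    have := hw.christoffel_darboux N z x
    simp only [Polynomial.eval_mul, Polynomial.eval_sub, Polynomial.eval_X, Polynomial.eval_C,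
      Polynomial.eval_finsetSum]
    convert this using 1
    · congr 1
      exact Finset.sum_congr rfl fun n _ => by ring
    · ring
  have hd := congrArg (fun P => (Polynomial.derivative P).eval x) key
  simp only [Polynomial.derivative_mul, Polynomial.derivative_sub, Polynomial.derivative_X,
    Polynomial.derivative_C, Polynomial.eval_add, Polynomial.eval_mul, Polynomial.eval_sub,
    Polynomial.eval_X, Polynomial.eval_C, Polynomial.eval_finsetSum, sub_self, zero_mul, add_zero,
    sub_zero, one_mul, zero_add] at hd
  convert hd using 1
  · exact Finset.sum_congr rfl fun n _ => by ring
  · ring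

end AdmissibleWeight

/-! ### Orthogonal polynomial ensembles are determinantal -/

lemma hasSum_mul_prod {ι κ : Type*} {f : ι → ℝ} {g : κ → ℝ} {a b : ℝ} (hf : HasSum f a)
    (hg : HasSum g b) : HasSum (fun y : ι × κ => f y.1 * g y.2) (a * b) :=
  hf.mul hg (summable_mul_of_summable_norm hf.summable.norm hg.summable.norm)

/-- An absolutely convergent sum over `ℕ^N` of a product of functions of one variable. -/
lemma hasSum_prod_fin {N : ℕ} (f : Fin N → ℕ → ℝ) (hf : ∀ i, Summable (f i)) :
    HasSum (fun x : Fin N → ℕ => ∏ i, f i (x i)) (∏ i, ∑' n, f i n) := by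
  induction N with
  | zero =>
    simp
  | succ N ih =>
    have h1 : HasSum (fun x : Fin N → ℕ => ∏ i, f i.succ (x i)) (∏ i : Fin N, ∑' n, f i.succ n) :=
      ih (fun i => f i.succ) fun i => hf i.succ
    have h3 : (fun x : Fin (N + 1) → ℕ => ∏ i, f i (x i)) ∘ (Fin.consEquiv fun _ => ℕ)
        = fun y : ℕ × (Fin N → ℕ) => f 0 y.1 * ∏ i, f i.succ (y.2 i) := by
      funext y
      simp [Fin.prod_univ_succ, Fin.consEquiv]
    rw [Fin.prod_univ_succ, ← (Fin.consEquiv fun _ : Fin (N + 1) => ℕ).hasSum_iff, h3]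
    have h4 := hasSum_mul_prod (hf 0).hasSum h1
    exact h4

/-- Andréief's identity for a discrete, possibly signed, measure `∑ m(n) δ_n`. -/
lemma hasSum_det_sq {N : ℕ} (φ : Fin N → ℕ → ℝ) (m : ℕ → ℝ)
    (h : ∀ i j, Summable fun n => φ i n * φ j n * m n) :
    HasSum (fun x : Fin N → ℕ => (Matrix.of fun i j => φ i (x j)).det ^ 2 * ∏ i, m (x i))
      (N.factorial * (Matrix.of fun i j => ∑' n, φ i n * φ j n * m n).det) := by
  set G : Matrix (Fin N) (Fin N) ℝ := Matrix.of fun i j => ∑' n, φ i n * φ j n * m n with hG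
  have hsum : HasSum (fun x : Fin N → ℕ => ∑ σ : Equiv.Perm (Fin N), ∑ τ : Equiv.Perm (Fin N),
      ((σ.sign : ℤ) : ℝ) * ((τ.sign : ℤ) : ℝ) * ∏ j, (φ (σ j) (x j) * φ (τ j) (x j) * m (x j)))
      (∑ σ : Equiv.Perm (Fin N), ∑ τ : Equiv.Perm (Fin N),
        ((σ.sign : ℤ) : ℝ) * ((τ.sign : ℤ) : ℝ) * ∏ j, G (σ j) (τ j)) :=
    hasSum_sum fun σ _ => hasSum_sum fun τ _ =>
      (hasSum_prod_fin (fun j n => φ (σ j) n * φ (τ j) n * m n) fun j => h _ _).mul_left _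
  convert hsum using 1
  · funext x
    rw [sq, Matrix.det_apply', Finset.sum_mul_sum, Finset.sum_mul]
    refine Finset.sum_congr rfl fun σ _ => ?_
    rw [Finset.sum_mul]
    refine Finset.sum_congr rfl fun τ _ => ?_
    simp only [Finset.prod_mul_distrib, Matrix.of_apply]
    ring
  · have hσ : ∀ σ : Equiv.Perm (Fin N), ∑ τ : Equiv.Perm (Fin N),
        ((σ.sign : ℤ) : ℝ) * ((τ.sign : ℤ) : ℝ) * ∏ j, G (σ j) (τ j) = G.det := by
      intro σ
      have h1 : ((G.submatrix σ id).transpose).det = ((σ.sign : ℤ) : ℝ) * G.det := by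
        rw [Matrix.det_transpose, Matrix.det_permute]
      rw [Matrix.det_apply'] at h1
      simp only [mul_assoc, ← Finset.mul_sum]
      simp only [Matrix.transpose_apply, Matrix.submatrix_apply, id] at h1
      rw [h1, ← mul_assoc, ← Int.cast_mul]
      simp [← Units.val_mul]
    simp [hσ, Fintype.card_perm]

/-- Expansion of `det (1 - K_B)` in principal minors, indexed by the subsets of `B`. -/
lemma det_one_sub_eq_sum_powerset (K : ℕ → ℕ → ℝ) (B : Finset ℕ) :
    (1 - Matrix.of fun a b : B => K a b).det
      = ∑ S ∈ B.powerset, (-1) ^ S.card * (Matrix.of fun a b : S => K a b).det := by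
  set M : Matrix B B ℝ := Matrix.of fun a b : B => K a b with hM
  have h1 : (1 - M).det = ∑ s : Finset B, ((-M).submatrix (Subtype.val : s → B)
      (Subtype.val : s → B)).det := by
    rw [sub_eq_add_neg, add_comm]
    refine (Matrix.detRowAlternating.map_add_univ (-M) (1 : Matrix B B ℝ)).trans ?_
    exact Finset.sum_congr rfl fun s _ => Matrix.det_piecewise_one_eq_submatrix_det (-M) s
  rw [h1]
  refine Finset.sum_bij (fun s _ => s.map (Function.Embedding.subtype _)) ?_ ?_ ?_ ?_
  · intro s _
    rw [Finset.mem_powerset]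
    intro a ha
    obtain ⟨b, -, rfl⟩ := Finset.mem_map.1 ha
    exact b.2
  · intro s _ t _ hst
    exact Finset.map_injective _ hst
  · intro S hS
    refine ⟨S.subtype (· ∈ B), Finset.mem_univ _, ?_⟩
    rw [Finset.subtype_map, Finset.filter_true_of_mem]
    exact fun a ha => Finset.mem_powerset.1 hS ha
  · intro s _
    let e := s.equivMap (Function.Embedding.subtype (· ∈ B))
    have h2 : (-M).submatrix (Subtype.val : s → B) (Subtype.val : s → B)
        = -((Matrix.of fun a b : (s.map (Function.Embedding.subtype _) : Finset ℕ) =>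
          K a b).submatrix e e) := by
      ext a b
      simp [hM, e, Finset.equivMap]
    rw [h2, Matrix.det_neg, Matrix.det_submatrix_equiv_self]
    simp

/-- A point process on `ℕ` whose gap probabilities are `det (1 - K_B)` is determinantal with
kernel `K`. -/
lemma isDeterminantalWithKernel_of_gap (P : Measure (Set ℕ)) [IsProbabilityMeasure P]
    (K : ℕ → ℕ → ℝ)
    (h : ∀ B : Finset ℕ, P.real {Y | ∀ b ∈ B, b ∉ Y} = (1 - Matrix.of fun a b : B => K a b).det) :
    IsDeterminantalWithKernel P K := by
  refine ⟨inferInstance, ?_⟩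
  have hmeas : ∀ b : ℕ, MeasurableSet {Y : Set ℕ | b ∈ Y} := fun b =>
    measurableSet_setOfPred.2 (measurable_set_mem b)
  have hinc : ∀ B : Finset ℕ, P.real {Y | ∀ b ∈ B, b ∉ Y}
      = ∑ S ∈ B.powerset, (-1) ^ S.card * P.real {Y : Set ℕ | (S : Set ℕ) ⊆ Y} := by
    intro B
    have h1 := measureReal_biUnion_eq_sum_powerset (μ := P) (t := B)
      (s := fun b => {Y : Set ℕ | b ∈ Y}) (fun b _ => hmeas b)
    have h2 : {Y : Set ℕ | ∀ b ∈ B, b ∉ Y} = (⋃ b ∈ B, {Y : Set ℕ | b ∈ Y})ᶜ := by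
      ext Y; simp
    rw [h2, probReal_compl_eq_one_sub (Finset.measurableSet_biUnion _ fun b _ => hmeas b), h1]
    have h3 : B.powerset = insert ∅ (B.powerset.filter (·.Nonempty)) := by
      ext S
      simp only [Finset.mem_insert, Finset.mem_filter, Finset.mem_powerset]
      rcases S.eq_empty_or_nonempty with rfl | hS
      · simp
      · simp [hS, hS.ne_empty]
    conv_rhs => rw [h3]
    rw [Finset.sum_insert (by simp)]
    have h4 : ∀ S : Finset ℕ, (⋂ i ∈ S, {Y : Set ℕ | i ∈ Y}) = {Y : Set ℕ | (S : Set ℕ) ⊆ Y} := by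
      intro S; ext Y; simp [Set.subset_def]
    simp only [h4, pow_succ, mul_neg, mul_one, neg_mul, Finset.sum_neg_distrib]
    simp
  -- Both sides of the claim have the same alternating sums over the subsets of every finite set, so
  -- they agree by induction on the set.
  intro A
  induction A using Finset.strongInduction with
  | H A ih =>
    have h1 := (hinc A).symm.trans ((h A).trans (det_one_sub_eq_sum_powerset K A))
    rw [← Finset.insert_erase (Finset.mem_powerset_self A),
      Finset.sum_insert (Finset.notMem_erase _ _), Finset.sum_insert (Finset.notMem_erase _ _),
      Finset.sum_congr rfl fun S hS => by
        rw [ih S (Finset.ssubset_iff_subset_ne.2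
          ⟨Finset.mem_powerset.1 (Finset.mem_of_mem_erase hS), Finset.ne_of_mem_erase hS⟩)]] at h1
    exact mul_left_cancel₀ (pow_ne_zero _ (by norm_num)) (add_right_cancel h1)

namespace AdmissibleWeight

variable {w : ℝ → ℝ}

lemma opeDensity_eq (w : ℝ → ℝ) (N : ℕ) (x : Fin N → ℕ) : opeDensity w N x
    = (Matrix.of fun i j : Fin N => (monicOrthPoly w i).eval (x j : ℝ)).det ^ 2
      * ∏ i, w (x i) := by
  have h1 := Matrix.det_eval_matrixOfPolynomials_eq_det_vandermonde (fun i => (x i : ℝ))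
    (fun i : Fin N => monicOrthPoly w i) (fun i => natDegree_monicOrthPoly w i)
    (fun i => monicOrthPoly_monic w i)
  rw [← Matrix.det_transpose]
  change _ = (Matrix.of fun i j : Fin N => (monicOrthPoly w j).eval (x i : ℝ)).det ^ 2 * _
  rw [← h1, Matrix.det_vandermonde, opeDensity]
  simp only [← Finset.prod_pow]
  congr 1
  exact Finset.prod_congr rfl fun i _ => Finset.prod_congr rfl fun j _ => by ring

lemma opeDensity_nonneg (hw : AdmissibleWeight w) (N : ℕ) (x : Fin N → ℕ) :
    0 ≤ opeDensity w N x :=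
  mul_nonneg (Finset.prod_nonneg fun _ _ => Finset.prod_nonneg fun _ _ => sq_nonneg _)
    (Finset.prod_nonneg fun _ _ => (hw.pos _).le)

/-- The sum of the density over the configurations avoiding `B`. -/
lemma hasSum_opeDensity_gap (hw : AdmissibleWeight w) (N : ℕ) (B : Finset ℕ) :
    HasSum (fun x : Fin N → ℕ => opeDensity w N x * ∏ i, if x i ∈ B then 0 else 1)
      (N.factorial * (Matrix.of fun i j : Fin N =>
        pairing w (monicOrthPoly w i) (monicOrthPoly w j) - ∑ b ∈ B,
          (monicOrthPoly w i).eval (b : ℝ) * (monicOrthPoly w j).eval (b : ℝ) * w b).det) := by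
  have hs : ∀ i j : Fin N, HasSum (fun n : ℕ => (monicOrthPoly w i).eval (n : ℝ)
      * (monicOrthPoly w j).eval (n : ℝ) * (w n * if n ∈ B then 0 else 1))
      (pairing w (monicOrthPoly w i) (monicOrthPoly w j) - ∑ b ∈ B,
          (monicOrthPoly w i).eval (b : ℝ) * (monicOrthPoly w j).eval (b : ℝ) * w b) := by
    intro i j
    have h1 : HasSum (fun n : ℕ => (monicOrthPoly w i).eval (n : ℝ)
        * (monicOrthPoly w j).eval (n : ℝ) * w n)
        (pairing w (monicOrthPoly w i) (monicOrthPoly w j)) := by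
      have := (hw.summable_eval (monicOrthPoly w i * monicOrthPoly w j))
      simp only [Polynomial.eval_mul] at this
      exact this.hasSum
    have h2 : HasSum (fun n : ℕ => if n ∈ B then (monicOrthPoly w i).eval (n : ℝ)
        * (monicOrthPoly w j).eval (n : ℝ) * w n else 0) (∑ b ∈ B,
          (monicOrthPoly w i).eval (b : ℝ) * (monicOrthPoly w j).eval (b : ℝ) * w b) := by
      rw [← Finset.sum_congr rfl fun b hb => if_pos hb]
      exact hasSum_sum_of_ne_finset_zero fun b hb => if_neg hb
    have h3 : (fun n : ℕ => (monicOrthPoly w i).eval (n : ℝ) * (monicOrthPoly w j).eval (n : ℝ)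
        * (w n * if n ∈ B then 0 else 1)) = fun n : ℕ => (monicOrthPoly w i).eval (n : ℝ)
        * (monicOrthPoly w j).eval (n : ℝ) * w n - if n ∈ B then (monicOrthPoly w i).eval (n : ℝ)
        * (monicOrthPoly w j).eval (n : ℝ) * w n else 0 := by
      funext n
      split_ifs <;> simp
    rw [h3]
    exact h1.sub h2
  -- Andréief's identity for the weight restricted to the complement of `B`
  have h := hasSum_det_sq (fun (i : Fin N) n => (monicOrthPoly w i).eval (n : ℝ))
    (fun n : ℕ => w n * if n ∈ B then 0 else 1) (fun i j => (hs i j).summable)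
  simp only [(hs _ _).tsum_eq] at h
  convert h using 1
  funext x
  rw [opeDensity_eq, Finset.prod_mul_distrib, mul_assoc]

/-- The partition function of the ensemble is `N! ∏_{n < N} h_n`. -/
lemma hasSum_opeDensity (hw : AdmissibleWeight w) (N : ℕ) : HasSum (opeDensity w N)
    (N.factorial * ∏ n ∈ Finset.range N,
      pairing w (monicOrthPoly w n) (monicOrthPoly w n)) := by
  have h := hw.hasSum_opeDensity_gap N ∅
  simp only [Finset.notMem_empty, if_false, Finset.prod_const_one, mul_one, Finset.sum_empty,
    sub_zero] at h
  convert h using 2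
  rw [← Fin.prod_univ_eq_prod_range (fun n => pairing w (monicOrthPoly w n) (monicOrthPoly w n)),
    ← Matrix.det_diagonal]
  congr 1
  ext i j
  rcases eq_or_ne i j with rfl | hij
  · simp
  · rw [Matrix.diagonal_apply_ne _ hij]
    exact (hw.pairing_monicOrthPoly_of_ne (Fin.val_ne_of_ne hij)).symm

lemma partition_pos (hw : AdmissibleWeight w) (N : ℕ) : 0 < (N.factorial : ℝ) *
    ∏ n ∈ Finset.range N, pairing w (monicOrthPoly w n) (monicOrthPoly w n) :=
  mul_pos (by exact_mod_cast N.factorial_pos)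
    (Finset.prod_pos fun n _ => hw.pairing_monicOrthPoly_pos n)

lemma opeMeasure_apply (hw : AdmissibleWeight w) (N : ℕ) (S : Set (Fin N → ℕ)) :
    opeMeasure w N S = ENNReal.ofReal
      ((∑' x, S.indicator (opeDensity w N) x) / ∑' x, opeDensity w N x) := by
  have hZ := (hw.hasSum_opeDensity N).tsum_eq
  have hS : MeasurableSet S := S.to_countable.measurableSet
  rw [opeMeasure, Measure.sum_apply _ hS, hZ, ← tsum_div_const,
    ENNReal.ofReal_tsum_of_nonneg (fun x => div_nonneg
      (Set.indicator_nonneg (fun y _ => hw.opeDensity_nonneg N y) x) (hw.partition_pos N).le)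
      (((hw.hasSum_opeDensity N).summable.indicator S).div_const _)]
  refine tsum_congr fun x => ?_
  by_cases hx : x ∈ S <;> simp [Measure.dirac_apply' _ hS, hx]

lemma measurable_range (N : ℕ) : Measurable fun x : Fin N → ℕ => Set.range x :=
  measurable_of_countable _

lemma isProbabilityMeasure_opeProcess (hw : AdmissibleWeight w) (N : ℕ) :
    IsProbabilityMeasure (opeProcess w N) := by
  have h : IsProbabilityMeasure (opeMeasure w N) := by
    refine ⟨?_⟩
    rw [hw.opeMeasure_apply, Set.indicator_univ, div_self, ENNReal.ofReal_one]
    rw [(hw.hasSum_opeDensity N).tsum_eq]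
    exact (hw.partition_pos N).ne'
  exact Measure.isProbabilityMeasure_map (measurable_range N).aemeasurable

/-- The gap probability of the ensemble is a Fredholm determinant of the Christoffel–Darboux
kernel. -/
lemma opeProcess_gap (hw : AdmissibleWeight w) (N : ℕ) (B : Finset ℕ) :
    (opeProcess w N).real {Y | ∀ b ∈ B, b ∉ Y}
      = (1 - Matrix.of fun a b : B => cdKernel w N (a : ℕ) (b : ℕ)).det := by
  set p : Fin N → ℕ → ℝ := fun i n => (monicOrthPoly w i).eval (n : ℝ) with hp
  set h : Fin N → ℝ := fun i => pairing w (monicOrthPoly w i) (monicOrthPoly w i) with hh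
  have hpos : ∀ i, 0 < h i := fun i => hw.pairing_monicOrthPoly_pos i
  have hmeas : MeasurableSet {Y : Set ℕ | ∀ b ∈ B, b ∉ Y} := by
    have h2 : {Y : Set ℕ | ∀ b ∈ B, b ∉ Y} = (⋃ b ∈ B, {Y : Set ℕ | b ∈ Y})ᶜ := by
      ext Y; simp
    rw [h2]
    exact (Finset.measurableSet_biUnion _ fun b _ =>
      measurableSet_setOfPred.2 (measurable_set_mem b)).compl
  have hind : ∀ x : Fin N → ℕ, ((fun x : Fin N → ℕ => Set.range x) ⁻¹'
      {Y : Set ℕ | ∀ b ∈ B, b ∉ Y}).indicator (opeDensity w N) x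
      = opeDensity w N x * ∏ i, if x i ∈ B then 0 else 1 := by
    intro x
    by_cases hx : ∃ i, x i ∈ B
    · obtain ⟨i, hi⟩ := hx
      rw [Set.indicator_of_notMem, Finset.prod_eq_zero (Finset.mem_univ i) (by simp [hi]), mul_zero]
      exact fun hmem => hmem _ hi ⟨i, rfl⟩
    · push Not at hx
      rw [Set.indicator_of_mem, Finset.prod_eq_one fun i _ => if_neg (hx i), mul_one]
      rintro b hb ⟨i, rfl⟩
      exact hx i hb
  rw [measureReal_def, opeProcess, Measure.map_apply (measurable_range N) hmeas,
    hw.opeMeasure_apply, ENNReal.toReal_ofReal (div_nonneg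
      (tsum_nonneg fun x => Set.indicator_nonneg (fun y _ => hw.opeDensity_nonneg N y) x)
      (tsum_nonneg fun x => hw.opeDensity_nonneg N x)),
    (hw.hasSum_opeDensity N).tsum_eq, tsum_congr hind, (hw.hasSum_opeDensity_gap N B).tsum_eq,
    ← Fin.prod_univ_eq_prod_range (fun n => pairing w (monicOrthPoly w n) (monicOrthPoly w n)),
    mul_div_mul_left _ _ (by exact_mod_cast N.factorial_ne_zero)]
  -- the orthonormal functions `p_i √w / √h_i`, restricted to `B`
  set Ψ : Matrix (Fin N) B ℝ := Matrix.of fun i b => p i b * √(w (b : ℕ)) / √(h i) with hΨ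
  have hK : (Matrix.of fun a b : B => cdKernel w N (a : ℕ) (b : ℕ)) = Ψ.transpose * Ψ := by
    ext a b
    rw [Matrix.of_apply, cdKernel, Real.sqrt_mul (hw.pos _).le, Finset.mul_sum, Matrix.mul_apply,
      ← Fin.sum_univ_eq_sum_range (fun n => √(w (a : ℕ)) * √(w (b : ℕ)) *
        ((monicOrthPoly w n).eval ((a : ℕ) : ℝ) * (monicOrthPoly w n).eval ((b : ℕ) : ℝ)
          / pairing w (monicOrthPoly w n) (monicOrthPoly w n)))]
    refine Finset.sum_congr rfl fun i _ => ?_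
    have h1 : √(h i) * √(h i) = h i := Real.mul_self_sqrt (hpos i).le
    change √(w (a : ℕ)) * √(w (b : ℕ)) * (p i a * p i b / h i)
      = p i a * √(w (a : ℕ)) / √(h i) * (p i b * √(w (b : ℕ)) / √(h i))
    rw [div_mul_div_comm, h1]
    ring
  rw [hK, ← Matrix.det_one_sub_mul_comm]
  have hG : (Matrix.of fun i j : Fin N =>
      pairing w (monicOrthPoly w i) (monicOrthPoly w j) - ∑ b ∈ B,
        (monicOrthPoly w i).eval (b : ℝ) * (monicOrthPoly w j).eval (b : ℝ) * w b)
      = Matrix.diagonal (fun i => √(h i)) * (1 - Ψ * Ψ.transpose)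
        * Matrix.diagonal (fun i => √(h i)) := by
    ext i j
    have h1 : ∀ i, √(h i) ≠ 0 := fun i => (Real.sqrt_pos.2 (hpos i)).ne'
    rw [Matrix.mul_diagonal, Matrix.diagonal_mul, Matrix.sub_apply, Matrix.mul_apply, mul_sub,
      sub_mul, Matrix.of_apply]
    congr 1
    · rcases eq_or_ne i j with rfl | hij
      · rw [Matrix.one_apply_eq, mul_one, Real.mul_self_sqrt (hpos i).le]
      · rw [Matrix.one_apply_ne hij, mul_zero, zero_mul]
        exact hw.pairing_monicOrthPoly_of_ne (Fin.val_ne_of_ne hij)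
    · rw [Finset.mul_sum, Finset.sum_mul, ← Finset.sum_coe_sort B]
      refine Finset.sum_congr rfl fun b _ => ?_
      have h2 : √(w (b : ℕ)) * √(w (b : ℕ)) = w (b : ℕ) := Real.mul_self_sqrt (hw.pos _).le
      have h3 := h1 i
      have h4 := h1 j
      change p i b * p j b * w (b : ℕ) = √(h i) * (p i b * √(w (b : ℕ)) / √(h i)
        * (p j b * √(w (b : ℕ)) / √(h j))) * √(h j)
      generalize √(w (b : ℕ)) = s at h2
      rw [← h2]
      field_simp
  rw [hG, Matrix.det_mul, Matrix.det_mul, Matrix.det_diagonal]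
  have h5 : (∏ i, √(h i)) * ∏ i, √(h i) = ∏ i, h i := by
    rw [← Finset.prod_mul_distrib]
    exact Finset.prod_congr rfl fun i _ => Real.mul_self_sqrt (hpos i).le
  rw [mul_right_comm, h5, mul_div_cancel_left₀ _ (Finset.prod_pos fun i _ => hpos i).ne']

/-- An orthogonal polynomial ensemble is determinantal with the Christoffel–Darboux kernel. -/
theorem isDeterminantalWithKernel_ope (hw : AdmissibleWeight w) (N : ℕ) :
    IsDeterminantalWithKernel (opeProcess w N) fun a b : ℕ => cdKernel w N a b :=
  have := hw.isProbabilityMeasure_opeProcess N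
  isDeterminantalWithKernel_of_gap _ _ (hw.opeProcess_gap N)

end AdmissibleWeight

/-! ### Confluent determinants -/

/-- The `2k × 2k` determinant whose column `j` consists of the entries `f j i` (`i = 1, …, k`)
followed by the entries `g j i` (`i = 1, …, k`). In the applications `f j` and `g j` are the values
and the derivatives of a function at `k` points. -/
noncomputable def confluentDet {k : ℕ} (f g : Fin (2 * k) → Fin k → ℝ) : ℝ :=
  Matrix.det (Matrix.of fun i j : Fin (2 * k) =>
    if h : i.val < k then f j ⟨i.val, h⟩ else g j ⟨i.val - k, by omega⟩)

/-- The `(2k+1) × (2k+1)` determinant with rows as in `confluentDet` and a last row `v`. -/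
noncomputable def borderedDet {k : ℕ} (f g : Fin (2 * k + 1) → Fin k → ℝ)
    (v : Fin (2 * k + 1) → ℝ) : ℝ :=
  Matrix.det (Matrix.of fun i j : Fin (2 * k + 1) =>
    if h : i.val < k then f j ⟨i.val, h⟩
    else if h' : i.val < 2 * k then g j ⟨i.val - k, by omega⟩ else v j)

lemma borderedDet_eq_sum {k : ℕ} (f g : Fin (2 * k + 1) → Fin k → ℝ) (v : Fin (2 * k + 1) → ℝ) :
    borderedDet f g v = ∑ j : Fin (2 * k + 1), (-1) ^ j.val *
      confluentDet (fun i => f (j.succAbove i)) (fun i => g (j.succAbove i)) * v j := by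
  rw [borderedDet, Matrix.det_succ_row _ (Fin.last (2 * k))]
  refine Finset.sum_congr rfl fun j _ => ?_
  have h1 : ¬ (Fin.last (2 * k)).val < k := by simp; omega
  have h2 : ¬ (Fin.last (2 * k)).val < 2 * k := by simp
  rw [Matrix.of_apply, dif_neg h1, dif_neg h2, Fin.val_last, pow_add, pow_mul, neg_one_sq, one_pow,
    one_mul, mul_right_comm, confluentDet]
  congr 3
  ext i l
  simp

lemma borderedDet_row_left {k : ℕ} (f g : Fin (2 * k + 1) → Fin k → ℝ) (i : Fin k) :
    borderedDet f g (fun j => f j i) = 0 := by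
  refine Matrix.det_zero_of_row_eq (i := ⟨i, by omega⟩) (j := Fin.last _) ?_ ?_
  · rw [Ne, Fin.ext_iff, Fin.val_last]
    have := i.2
    simp only
    omega
  · funext j
    have h1 : ¬ 2 * k < k := by omega
    simp [h1]

lemma borderedDet_row_right {k : ℕ} (f g : Fin (2 * k + 1) → Fin k → ℝ) (i : Fin k) :
    borderedDet f g (fun j => g j i) = 0 := by
  refine Matrix.det_zero_of_row_eq (i := ⟨k + i, by omega⟩) (j := Fin.last _) ?_ ?_
  · rw [Ne, Fin.ext_iff, Fin.val_last]
    have := i.2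
    simp only
    omega
  · funext j
    have h1 : ¬ 2 * k < k := by omega
    have h2 : k + i.val < 2 * k := by omega
    simp [h1, h2]

/-- Multiplying the underlying functions by a common function with values `s` and derivatives `s'`
at the nodes multiplies a confluent determinant by `∏ s²`. -/
lemma confluentDet_leibniz {k : ℕ} (f g : Fin (2 * k) → Fin k → ℝ) (s s' : Fin k → ℝ) :
    confluentDet (fun j i => s i * f j i) (fun j i => s' i * f j i + s i * g j i)
      = (∏ i, s i) ^ 2 * confluentDet f g := by
  set e : Fin k ⊕ Fin k ≃ Fin (2 * k) := finSumFinEquiv.trans (finCongr (two_mul k).symm) with he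
  rw [confluentDet, confluentDet, ← Matrix.det_submatrix_equiv_self e,
    ← Matrix.det_submatrix_equiv_self e (Matrix.of fun i j : Fin (2 * k) =>
      if h : i.val < k then f j ⟨i.val, h⟩ else g j ⟨i.val - k, by omega⟩)]
  have hM : (Matrix.fromBlocks (Matrix.diagonal s) 0 (Matrix.diagonal s') (Matrix.diagonal s)).det
      = (∏ i, s i) ^ 2 := by
    rw [Matrix.det_fromBlocks_zero₁₂, Matrix.det_diagonal, sq]
  rw [← hM, ← Matrix.det_mul]
  congr 1
  ext (i | i) j <;>
    simp [he, Matrix.mul_apply, Fintype.sum_sum_type, Matrix.diagonal_apply]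

lemma confluentDet_mul_column {k : ℕ} (f g : Fin (2 * k) → Fin k → ℝ) (t : Fin (2 * k) → ℝ) :
    confluentDet (fun j i => t j * f j i) (fun j i => t j * g j i)
      = (∏ j, t j) * confluentDet f g := by
  rw [confluentDet, confluentDet, ← Matrix.det_mul_row]
  congr 1
  ext i j
  simp only [Matrix.of_apply]
  split_ifs <;> rfl

lemma confluentDet_scale {k : ℕ} (f g : Fin (2 * k) → Fin k → ℝ) (s s' : Fin k → ℝ)
    (t : Fin (2 * k) → ℝ) :
    confluentDet (fun j i => t j * (s i * f j i)) (fun j i => t j * (s' i * f j i + s i * g j i))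
      = (∏ j, t j) * (∏ i, s i) ^ 2 * confluentDet f g := by
  rw [confluentDet_mul_column (fun j i => s i * f j i) fun j i => s' i * f j i + s i * g j i,
    confluentDet_leibniz, mul_assoc]

lemma borderedDet_scale {k : ℕ} (f g : Fin (2 * k + 1) → Fin k → ℝ) (v : Fin (2 * k + 1) → ℝ)
    (s s' : Fin k → ℝ) (t : Fin (2 * k + 1) → ℝ) (r : ℝ) :
    borderedDet (fun j i => t j * (s i * f j i)) (fun j i => t j * (s' i * f j i + s i * g j i))
      (fun j => t j * (r * v j)) = (∏ j, t j) * (∏ i, s i) ^ 2 * r * borderedDet f g v := by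
  rw [borderedDet_eq_sum, borderedDet_eq_sum, Finset.mul_sum]
  refine Finset.sum_congr rfl fun j _ => ?_
  rw [confluentDet_scale (fun i => f (j.succAbove i)) (fun i => g (j.succAbove i)) s s'
    (fun i => t (j.succAbove i)), Fin.prod_univ_succAbove t j]
  ring

lemma tendsto_confluentDet {k : ℕ} {ι : Type*} {l : Filter ι}
    {f g : ι → Fin (2 * k) → Fin k → ℝ} {f' g' : Fin (2 * k) → Fin k → ℝ}
    (hf : ∀ j i, Tendsto (fun n => f n j i) l (𝓝 (f' j i)))
    (hg : ∀ j i, Tendsto (fun n => g n j i) l (𝓝 (g' j i))) :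
    Tendsto (fun n => confluentDet (f n) (g n)) l (𝓝 (confluentDet f' g')) := by
  refine ((Continuous.matrix_det continuous_id).tendsto _).comp ?_
  refine tendsto_pi_nhds.2 fun i => tendsto_pi_nhds.2 fun j => ?_
  simp only [Matrix.of_apply]
  split_ifs
  · exact hf _ _
  · exact hg _ _

lemma tendsto_borderedDet {k : ℕ} {ι : Type*} {l : Filter ι}
    {f g : ι → Fin (2 * k + 1) → Fin k → ℝ} {f' g' : Fin (2 * k + 1) → Fin k → ℝ}
    {v : ι → Fin (2 * k + 1) → ℝ} {v' : Fin (2 * k + 1) → ℝ}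
    (hf : ∀ j i, Tendsto (fun n => f n j i) l (𝓝 (f' j i)))
    (hg : ∀ j i, Tendsto (fun n => g n j i) l (𝓝 (g' j i)))
    (hv : ∀ j, Tendsto (fun n => v n j) l (𝓝 (v' j))) :
    Tendsto (fun n => borderedDet (f n) (g n) (v n)) l (𝓝 (borderedDet f' g' v')) := by
  simp only [borderedDet_eq_sum]
  refine tendsto_finsetSum _ fun j _ => Tendsto.mul (Tendsto.const_mul _ ?_) (hv j)
  exact tendsto_confluentDet (fun _ _ => hf _ _) fun _ _ => hg _ _

lemma hasDerivAt_borderedDet {k : ℕ} (f g : Fin (2 * k + 1) → Fin k → ℝ)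
    {v : Fin (2 * k + 1) → ℝ → ℝ} {v' : Fin (2 * k + 1) → ℝ} {x : ℝ}
    (hv : ∀ j, HasDerivAt (v j) (v' j) x) :
    HasDerivAt (fun y => borderedDet f g fun j => v j y) (borderedDet f g v') x := by
  simp only [borderedDet_eq_sum]
  exact HasDerivAt.fun_sum fun j _ => (hv j).const_mul _

/-- A square matrix of linear functionals applied to a family of monic polynomials of degrees
`0, 1, 2, …` has a determinant that does not depend on the family. -/
lemma det_functional_monic {n : ℕ} (l : Fin n → Polynomial ℝ →ₗ[ℝ] ℝ) (q : Fin n → Polynomial ℝ)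
    (hq : ∀ j, (q j).Monic) (hd : ∀ j, (q j).natDegree = j) :
    (Matrix.of fun i j => l i (q j)).det = (Matrix.of fun i j : Fin n => l i (X ^ j.val)).det := by
  have h : (Matrix.of fun i j => l i (q j)) = (Matrix.of fun i j : Fin n => l i (X ^ j.val))
      * Matrix.of fun i j : Fin n => (q j).coeff i := by
    ext i j
    rw [Matrix.mul_apply, Matrix.of_apply]
    conv_lhs => rw [(q j).as_sum_range' n (by rw [hd]; exact j.2)]
    rw [map_sum, ← Fin.sum_univ_eq_sum_range
      (fun m => l i (Polynomial.monomial m ((q j).coeff m))) n]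
    refine Finset.sum_congr rfl fun m _ => ?_
    rw [← Polynomial.C_mul_X_pow_eq_monomial, ← Polynomial.smul_eq_C_mul, map_smul, smul_eq_mul,
      mul_comm, Matrix.of_apply, Matrix.of_apply]
  -- The matrix of coefficients is unitriangular.
  rw [h, Matrix.det_mul, Matrix.det_matrixOfPolynomials q hd hq, mul_one]

lemma confluentDet_eval_eq_det {k : ℕ} (v : Fin k → ℝ) (q : Fin (2 * k) → Polynomial ℝ) :
    confluentDet (fun j i => (q j).eval (v i)) (fun j i => (q j).derivative.eval (v i))
      = (Matrix.of fun i j : Fin (2 * k) => (if h : i.val < k then Polynomial.leval (v ⟨i.val, h⟩)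
        else Polynomial.leval (v ⟨i.val - k, by omega⟩) ∘ₗ Polynomial.derivative) (q j)).det := by
  rw [confluentDet]
  congr 1
  ext i j
  simp only [Matrix.of_apply]
  split_ifs <;> simp [Polynomial.leval_apply]

/-- The confluent Vandermonde determinant is unchanged when powers are replaced by other monic
polynomials, evaluated at translated nodes. -/
lemma confluentDet_monic_translate {k : ℕ} (u : Fin k → ℝ) (c : ℝ) (q : ℕ → Polynomial ℝ)
    (hq : ∀ j, (q j).Monic) (hd : ∀ j, (q j).natDegree = j) :
    confluentDet (fun (j : Fin (2 * k)) i => (q j).eval (u i + c))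
        (fun j i => (q j).derivative.eval (u i + c))
      = confluentDet (fun (j : Fin (2 * k)) i => (X ^ j.val : Polynomial ℝ).eval (u i))
        (fun j i => (X ^ j.val : Polynomial ℝ).derivative.eval (u i)) := by
  have h := confluentDet_eval_eq_det u fun j => (q j).comp (X + C c)
  simp only [Polynomial.derivative_comp, Polynomial.eval_comp,
    Polynomial.eval_add, Polynomial.eval_X, Polynomial.eval_C, Polynomial.derivative_add,
    Polynomial.derivative_X, Polynomial.derivative_C, add_zero, one_mul] at h
  rw [h, confluentDet_eval_eq_det u fun j => X ^ j.val]
  refine det_functional_monic _ _ (fun j => (hq j).comp_X_add_C c) fun j => ?_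
  rw [Polynomial.natDegree_comp, hd, Polynomial.natDegree_X_add_C, mul_one]

/-! ### Christoffel's formula for doubled nodes -/

/-- The polynomial `∏ (X - v_i)²`. -/
noncomputable def nodePoly {k : ℕ} (v : Fin k → ℝ) : Polynomial ℝ := ∏ i, (X - C (v i)) ^ 2

lemma nodePoly_monic {k : ℕ} (v : Fin k → ℝ) : (nodePoly v).Monic :=
  Polynomial.monic_prod_of_monic _ _ fun i _ => (Polynomial.monic_X_sub_C (v i)).pow 2

lemma natDegree_nodePoly {k : ℕ} (v : Fin k → ℝ) : (nodePoly v).natDegree = 2 * k := by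
  rw [nodePoly, Polynomial.natDegree_prod_of_monic _ _ fun i _ =>
    (Polynomial.monic_X_sub_C (v i)).pow 2]
  simp [mul_comm]

lemma eval_nodePoly {k : ℕ} (v : Fin k → ℝ) (x : ℝ) :
    (nodePoly v).eval x = ∏ i, (x - v i) ^ 2 := by
  simp [nodePoly, Polynomial.eval_prod]

lemma nodePoly_dvd {k : ℕ} {v : Fin k → ℝ} (hv : Function.Injective v) {Q : Polynomial ℝ}
    (h0 : ∀ i, Q.eval (v i) = 0) (h1 : ∀ i, Q.derivative.eval (v i) = 0) : nodePoly v ∣ Q := by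
  refine Finset.prod_dvd_of_coprime (fun i _ j _ hij => ?_) fun i _ => ?_
  · exact (Polynomial.pairwise_coprime_X_sub_C hv hij).pow
  · by_cases hQ : Q = 0
    · simp [hQ]
    rw [← Polynomial.le_rootMultiplicity_iff hQ]
    exact (Polynomial.one_lt_rootMultiplicity_iff_isRoot hQ).2 ⟨h0 i, h1 i⟩

/-- The confluent determinant of the orthogonal polynomials of degrees `c 0, …, c (2k-1)` at the
nodes `v`. -/
noncomputable def opMinor {k : ℕ} (w : ℝ → ℝ) (v : Fin k → ℝ) (c : Fin (2 * k) → ℕ) : ℝ :=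
  confluentDet (fun j i => (monicOrthPoly w (c j)).eval (v i))
    fun j i => (monicOrthPoly w (c j)).derivative.eval (v i)

/-- Christoffel's determinant: the bordered confluent determinant of the orthogonal polynomials of
degrees `n, …, n + 2k` at the nodes `v`, as a polynomial in the variable of the last row. -/
noncomputable def christoffelPoly {k : ℕ} (w : ℝ → ℝ) (v : Fin k → ℝ) (n : ℕ) : Polynomial ℝ :=
  ∑ j : Fin (2 * k + 1), ((-1) ^ j.val * opMinor w v fun i => n + (j.succAbove i).val) •
    monicOrthPoly w (n + j.val)

lemma eval_christoffelPoly {k : ℕ} (w : ℝ → ℝ) (v : Fin k → ℝ) (n : ℕ) (x : ℝ) :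
    (christoffelPoly w v n).eval x
      = borderedDet (fun j i => (monicOrthPoly w (n + j.val)).eval (v i))
        (fun j i => (monicOrthPoly w (n + j.val)).derivative.eval (v i))
        fun j => (monicOrthPoly w (n + j.val)).eval x := by
  rw [borderedDet_eq_sum, christoffelPoly, Polynomial.eval_finsetSum]
  exact Finset.sum_congr rfl fun j _ => by rw [Polynomial.eval_smul, smul_eq_mul, opMinor]

lemma eval_derivative_christoffelPoly {k : ℕ} (w : ℝ → ℝ) (v : Fin k → ℝ) (n : ℕ) (x : ℝ) :
    (christoffelPoly w v n).derivative.eval x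
      = borderedDet (fun j i => (monicOrthPoly w (n + j.val)).eval (v i))
        (fun j i => (monicOrthPoly w (n + j.val)).derivative.eval (v i))
        fun j => (monicOrthPoly w (n + j.val)).derivative.eval x := by
  rw [borderedDet_eq_sum, christoffelPoly, Polynomial.derivative_sum, Polynomial.eval_finsetSum]
  exact Finset.sum_congr rfl fun j _ => by
    rw [Polynomial.derivative_smul, Polynomial.eval_smul, smul_eq_mul, opMinor]

lemma nodePoly_dvd_christoffelPoly {k : ℕ} (w : ℝ → ℝ) {v : Fin k → ℝ}
    (hv : Function.Injective v) (n : ℕ) : nodePoly v ∣ christoffelPoly w v n := by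
  refine nodePoly_dvd hv (fun i => ?_) fun i => ?_
  · rw [eval_christoffelPoly]
    exact borderedDet_row_left _ _ i
  · rw [eval_derivative_christoffelPoly]
    exact borderedDet_row_right _ _ i

namespace AdmissibleWeight

variable {w : ℝ → ℝ} {k : ℕ} {v : Fin k → ℝ}

lemma christoffelWeight_eq (w : ℝ → ℝ) (v : Fin k → ℝ) (x : ℝ) :
    christoffelWeight w v x = (nodePoly v).eval x * w x := by
  rw [eval_nodePoly, christoffelWeight]

lemma christoffel (hw : AdmissibleWeight w) (hZ : ∀ i, ∀ n : ℕ, v i ≠ n) :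
    AdmissibleWeight (christoffelWeight w v) where
  pos n := mul_pos (Finset.prod_pos fun i _ => by
    have : (n : ℝ) - v i ≠ 0 := sub_ne_zero.2 (hZ i n).symm
    positivity) (hw.pos n)
  summable_pow m := by
    have h := hw.summable_eval (X ^ m * nodePoly v)
    simp only [Polynomial.eval_mul, Polynomial.eval_pow, Polynomial.eval_X, mul_assoc] at h
    simpa only [christoffelWeight_eq] using h

lemma functional_christoffelWeight (hw : AdmissibleWeight w)
    (hw' : AdmissibleWeight (christoffelWeight w v)) (P : Polynomial ℝ) :
    hw'.functional P = hw.functional (nodePoly v * P) := by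
  change ∑' n : ℕ, _ = ∑' n : ℕ, _
  refine tsum_congr fun n => ?_
  rw [christoffelWeight_eq, Polynomial.eval_mul]
  ring

lemma degree_sum_lt (w : ℝ → ℝ) (n m : ℕ) (b : Fin m → ℝ) :
    (∑ j : Fin m, b j • monicOrthPoly w (n + j.val)).degree < (n + m : ℕ) := by
  rw [← Polynomial.mem_degreeLT]
  refine Submodule.sum_mem _ fun j _ => Submodule.smul_mem _ _ ?_
  rw [Polynomial.mem_degreeLT, degree_monicOrthPoly]
  exact_mod_cast (by omega : n + j.val < n + m)

/-- A combination of `p_n, …, p_{n+2k-1}` with double zeros at `k` points off `ℕ` vanishes: divided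
by `∏ (x - v_i)²` it has degree `< n`, so it is orthogonal to its own quotient. -/
lemma eq_zero_of_double_zeros (hw : AdmissibleWeight w)
    (hZ : ∀ i, ∀ n : ℕ, v i ≠ n) (n : ℕ) (b : Fin (2 * k) → ℝ)
    (h : nodePoly v ∣ ∑ j, b j • monicOrthPoly w (n + j.val)) : b = 0 := by
  obtain ⟨R, hR⟩ := h
  have hw' := hw.christoffel hZ
  have hR0 : R = 0 := by
    by_contra hne
    have hdeg : R.degree < n := by
      have h1 := degree_sum_lt w n (2 * k) b
      rw [hR, Polynomial.degree_mul, (Polynomial.degree_eq_iff_natDegree_eq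
        (nodePoly_monic v).ne_zero).2 (natDegree_nodePoly v),
        Polynomial.degree_eq_natDegree hne] at h1
      rw [Polynomial.degree_eq_natDegree hne]
      norm_cast at h1 ⊢
      omega
    refine hne (hw'.eq_zero_of_functional_sq ?_)
    rw [hw.functional_christoffelWeight hw', ← mul_assoc, ← hR, Finset.sum_mul, map_sum]
    refine Finset.sum_eq_zero fun j _ => ?_
    rw [smul_mul_assoc, map_smul, hw.functional_monicOrthPoly_mul, smul_zero]
    exact hdeg.trans_le (by exact_mod_cast Nat.le_add_right n j)
  rw [hR0, mul_zero] at hR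
  funext j
  have h1 : hw.functional ((∑ j, b j • monicOrthPoly w (n + j.val)) * monicOrthPoly w (n + j.val))
      = 0 := by rw [hR, zero_mul, map_zero]
  rw [Finset.sum_mul, map_sum, Finset.sum_eq_single j] at h1
  · rw [smul_mul_assoc, map_smul, ← hw.pairing_eq, smul_eq_mul] at h1
    exact (mul_eq_zero.1 h1).resolve_right (hw.pairing_monicOrthPoly_pos _).ne'
  · intro l _ hl
    rw [smul_mul_assoc, map_smul, ← hw.pairing_eq, hw.pairing_monicOrthPoly_of_ne, smul_zero]
    have := Fin.val_ne_of_ne hl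
    omega
  · simp

/-- A vanishing determinant would give a nonzero combination as in `eq_zero_of_double_zeros`. -/
lemma opMinor_ne_zero (hw : AdmissibleWeight w) (hv : Function.Injective v)
    (hZ : ∀ i, ∀ n : ℕ, v i ≠ n) (n : ℕ) : opMinor w v (fun j => n + j.val) ≠ 0 := by
  intro h
  rw [opMinor, confluentDet] at h
  obtain ⟨b, hb, hb'⟩ := Matrix.exists_mulVec_eq_zero_iff.2 h
  refine hb (hw.eq_zero_of_double_zeros hZ n b (nodePoly_dvd hv (fun i => ?_) fun i => ?_))
  · have := congrFun hb' ⟨i, by omega⟩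
    simp only [Matrix.mulVec, dotProduct, Matrix.of_apply, i.2, dif_pos, Pi.zero_apply] at this
    rw [Polynomial.eval_finsetSum, ← this]
    exact Finset.sum_congr rfl fun j _ => by rw [Polynomial.eval_smul, smul_eq_mul, mul_comm]
  · have := congrFun hb' ⟨k + i, by omega⟩
    have hi : ¬ k + i.val < k := by omega
    simp only [Matrix.mulVec, dotProduct, Matrix.of_apply, hi, dif_neg, not_false_iff,
      Pi.zero_apply, Nat.add_sub_cancel_left] at this
    rw [Polynomial.derivative_sum, Polynomial.eval_finsetSum, ← this]
    exact Finset.sum_congr rfl fun j _ => by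
      rw [Polynomial.derivative_smul, Polynomial.eval_smul, smul_eq_mul, mul_comm]

/-- Christoffel's formula. The determinant is divisible by `∏ (X - v_i)²`, because it has two equal
rows at each node and so does its derivative; the quotient, made monic, has degree `n` and is
orthogonal to all lower degrees for the deformed weight. -/
lemma christoffelPoly_eq (hw : AdmissibleWeight w) (hv : Function.Injective v)
    (hZ : ∀ i, ∀ n : ℕ, v i ≠ n) (n : ℕ) :
    christoffelPoly w v n = opMinor w v (fun j => n + j.val) •
      (nodePoly v * monicOrthPoly (christoffelWeight w v) n) := by
  have hw' := hw.christoffel hZ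
  have hW := hw.opMinor_ne_zero hv hZ n
  set W := opMinor w v fun j => n + j.val with hWdef
  obtain ⟨R, hR⟩ := nodePoly_dvd_christoffelPoly w hv n
  have hD : W⁻¹ • christoffelPoly w v n = nodePoly v * (W⁻¹ • R) := by
    rw [hR, mul_smul_comm]
  have hdeg : (W⁻¹ • christoffelPoly w v n).Monic ∧
      (W⁻¹ • christoffelPoly w v n).natDegree = n + 2 * k := by
    have h1 : W⁻¹ • christoffelPoly w v n = W⁻¹ • (∑ j : Fin (2 * k),
        ((-1) ^ j.val * opMinor w v fun i => n + ((Fin.castSucc j).succAbove i).val) •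
          monicOrthPoly w (n + j.val)) + monicOrthPoly w (n + 2 * k) := by
      rw [christoffelPoly, Fin.sum_univ_castSucc, smul_add]
      simp only [Fin.val_castSucc, Fin.val_last, Fin.succAbove_last, pow_mul, neg_one_sq, one_pow,
        one_mul]
      rw [← hWdef, smul_smul, inv_mul_cancel₀ hW, one_smul]
    have h2 : (W⁻¹ • (∑ j : Fin (2 * k),
        ((-1) ^ j.val * opMinor w v fun i => n + ((Fin.castSucc j).succAbove i).val) •
          monicOrthPoly w (n + j.val))).degree < (monicOrthPoly w (n + 2 * k)).degree := by
      rw [degree_monicOrthPoly]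
      exact (Polynomial.degree_smul_le _ _).trans_lt (degree_sum_lt w n (2 * k) _)
    rw [h1]
    refine ⟨(monicOrthPoly_monic w _).add_of_right h2, ?_⟩
    rw [Polynomial.natDegree_eq_of_degree_eq (Polynomial.degree_add_eq_right_of_degree_lt h2),
      natDegree_monicOrthPoly]
  rw [hD] at hdeg
  have hmon : (W⁻¹ • R).Monic := (nodePoly_monic v).of_mul_monic_left hdeg.1
  have hnat : (W⁻¹ • R).natDegree = n := by
    have := hdeg.2
    rw [(nodePoly_monic v).natDegree_mul hmon, natDegree_nodePoly] at this
    omega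
  rw [← hw'.eq_monicOrthPoly hmon hnat, ← hD, smul_smul, mul_inv_cancel₀ hW, one_smul]
  intro Q hQ
  rw [hw.functional_christoffelWeight hw', ← mul_assoc, ← hD, smul_mul_assoc, map_smul,
    christoffelPoly, Finset.sum_mul, map_sum, Finset.sum_eq_zero, smul_zero]
  intro j _
  rw [smul_mul_assoc, map_smul, hw.functional_monicOrthPoly_mul, smul_zero]
  exact hQ.trans_le (by exact_mod_cast Nat.le_add_right n j)

/-- The squared norms of the orthogonal polynomials of a Christoffel deformation: in the pairing of
Christoffel's determinant with `X^n`, only the term with `p_n` survives. -/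
lemma pairing_christoffelWeight (hw : AdmissibleWeight w) (hv : Function.Injective v)
    (hZ : ∀ i, ∀ n : ℕ, v i ≠ n) (n : ℕ) :
    pairing (christoffelWeight w v)
        (monicOrthPoly (christoffelWeight w v) n)
        (monicOrthPoly (christoffelWeight w v) n)
      = opMinor w v (fun j => n + 1 + j.val) / opMinor w v (fun j => n + j.val)
        * pairing w (monicOrthPoly w n) (monicOrthPoly w n) := by
  have hw' := hw.christoffel hZ
  have hW := hw.opMinor_ne_zero hv hZ n
  have hXn : ((X : Polynomial ℝ) ^ n).Monic := Polynomial.monic_X_pow n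
  have hXd : ((X : Polynomial ℝ) ^ n).natDegree = n := Polynomial.natDegree_X_pow n
  have hdeg : ((X : Polynomial ℝ) ^ n).degree = n := Polynomial.degree_X_pow n
  have h0 : (fun i => n + ((0 : Fin (2 * k + 1)).succAbove i).val)
      = fun j : Fin (2 * k) => n + 1 + j.val := by
    funext i
    simp
    ring
  rw [← hw'.functional_monicOrthPoly_mul_monic hXn hXd, hw.functional_christoffelWeight hw',
    ← hw.functional_monicOrthPoly_mul_monic hXn hXd, ← mul_assoc, div_mul_eq_mul_div,
    eq_div_iff hW, mul_comm, ← smul_eq_mul, ← map_smul, ← smul_mul_assoc,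
    ← hw.christoffelPoly_eq hv hZ n, christoffelPoly, Finset.sum_mul, map_sum, Fin.sum_univ_succ,
    Finset.sum_eq_zero, add_zero, h0, smul_mul_assoc, map_smul]
  · simp
  · intro j _
    rw [smul_mul_assoc, map_smul, hw.functional_monicOrthPoly_mul, smul_zero]
    rw [hdeg]
    exact_mod_cast (by simp : n < n + j.succ.val)

end AdmissibleWeight

/-! ### The kernel of a Christoffel deformation -/

namespace AdmissibleWeight

variable {w : ℝ → ℝ} {k : ℕ} {v : Fin k → ℝ}

lemma prod_abs_sub_sq (v : Fin k → ℝ) (x y : ℝ) :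
    (∏ i, |(x - v i) * (y - v i)|) ^ 2 = (nodePoly v).eval x * (nodePoly v).eval y := by
  rw [eval_nodePoly, eval_nodePoly, ← Finset.prod_pow, ← Finset.prod_mul_distrib]
  exact Finset.prod_congr rfl fun i _ => by rw [sq_abs, mul_pow]

lemma sqrt_christoffelWeight (w : ℝ → ℝ) (v : Fin k → ℝ) (x y : ℝ) :
    √(christoffelWeight w v x * christoffelWeight w v y)
      = (∏ i, |(x - v i) * (y - v i)|) * √(w x * w y) := by
  rw [christoffelWeight_eq, christoffelWeight_eq, mul_mul_mul_comm, ← prod_abs_sub_sq,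
    Real.sqrt_mul (sq_nonneg _), Real.sqrt_sq (Finset.prod_nonneg fun i _ => abs_nonneg _)]

lemma eval_christoffelPoly_eq (hw : AdmissibleWeight w) (hv : Function.Injective v)
    (hZ : ∀ i, ∀ n : ℕ, v i ≠ n) (n : ℕ) (x : ℝ) :
    (christoffelPoly w v n).eval x = opMinor w v (fun j => n + j.val) *
      ((nodePoly v).eval x * (monicOrthPoly (christoffelWeight w v) n).eval x) := by
  rw [hw.christoffelPoly_eq hv hZ, Polynomial.eval_smul, smul_eq_mul, Polynomial.eval_mul]

/-- The Christoffel–Darboux kernel of a Christoffel deformation in terms of the original orthogonal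
polynomials. -/
lemma cdKernel_christoffelWeight (hw : AdmissibleWeight w) (hv : Function.Injective v)
    (hZ : ∀ i, ∀ n : ℕ, v i ≠ n) (M : ℕ) {x y : ℝ} (hxy : x ≠ y) (hx : ∀ i, x ≠ v i)
    (hy : ∀ i, y ≠ v i) :
    cdKernel (christoffelWeight w v) (M + 1) x y
      = √(w x * w y) / (opMinor w v (fun j => M + 1 + j.val) ^ 2
          * pairing w (monicOrthPoly w M) (monicOrthPoly w M) * ∏ i, |(x - v i) * (y - v i)|)
        * (((christoffelPoly w v (M + 1)).eval x * (christoffelPoly w v M).eval y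
          - (christoffelPoly w v M).eval x * (christoffelPoly w v (M + 1)).eval y) / (x - y)) := by
  have hw' := hw.christoffel hZ
  have hCD := hw'.christoffel_darboux M x y
  have hxy' : x - y ≠ 0 := sub_ne_zero.2 hxy
  rw [mul_comm, ← eq_div_iff hxy'] at hCD
  have hP : ∏ i, |(x - v i) * (y - v i)| ≠ 0 := Finset.prod_ne_zero_iff.2 fun i _ =>
    abs_ne_zero.2 (mul_ne_zero (sub_ne_zero.2 (hx i)) (sub_ne_zero.2 (hy i)))
  have hPT := prod_abs_sub_sq v x y
  have hW := hw.opMinor_ne_zero hv hZ M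
  have hW' := hw.opMinor_ne_zero hv hZ (M + 1)
  have hh := (hw.pairing_monicOrthPoly_pos M).ne'
  rw [cdKernel, sqrt_christoffelWeight, hCD, hw.pairing_christoffelWeight hv hZ,
    hw.eval_christoffelPoly_eq hv hZ, hw.eval_christoffelPoly_eq hv hZ,
    hw.eval_christoffelPoly_eq hv hZ, hw.eval_christoffelPoly_eq hv hZ]
  set P := ∏ i, |(x - v i) * (y - v i)|
  set W := opMinor w v fun j => M + j.val
  set W' := opMinor w v fun j => M + 1 + j.val
  set Tx := (nodePoly v).eval x
  set Ty := (nodePoly v).eval y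
  set h := pairing w (monicOrthPoly w M) (monicOrthPoly w M)
  field_simp
  rw [hPT]
  ring

/-- The confluent form of `cdKernel_christoffelWeight`; the derivatives of `∏ (X - v_i)²` cancel. -/
lemma cdKernel_christoffelWeight_diag (hw : AdmissibleWeight w) (hv : Function.Injective v)
    (hZ : ∀ i, ∀ n : ℕ, v i ≠ n) (M : ℕ) {x : ℝ} (hx : ∀ i, x ≠ v i) :
    cdKernel (christoffelWeight w v) (M + 1) x x
      = √(w x * w x) / (opMinor w v (fun j => M + 1 + j.val) ^ 2
          * pairing w (monicOrthPoly w M) (monicOrthPoly w M) * ∏ i, (x - v i) ^ 2)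
        * ((christoffelPoly w v (M + 1)).derivative.eval x * (christoffelPoly w v M).eval x
          - (christoffelPoly w v M).derivative.eval x * (christoffelPoly w v (M + 1)).eval x) := by
  have hw' := hw.christoffel hZ
  have hCD := hw'.christoffel_darboux_diag M x
  have habs : ∏ i, |(x - v i) * (x - v i)| = (nodePoly v).eval x := by
    rw [eval_nodePoly]
    exact Finset.prod_congr rfl fun i _ => by rw [abs_mul_self, sq]
  have hP : (nodePoly v).eval x ≠ 0 := by
    rw [eval_nodePoly]
    exact Finset.prod_ne_zero_iff.2 fun i _ => pow_ne_zero 2 (sub_ne_zero.2 (hx i))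
  have hW := hw.opMinor_ne_zero hv hZ M
  have hW' := hw.opMinor_ne_zero hv hZ (M + 1)
  have hh := (hw.pairing_monicOrthPoly_pos M).ne'
  rw [cdKernel, sqrt_christoffelWeight, hCD, hw.pairing_christoffelWeight hv hZ, habs,
    hw.christoffelPoly_eq hv hZ, hw.christoffelPoly_eq hv hZ, ← eval_nodePoly]
  simp only [Polynomial.derivative_smul, Polynomial.derivative_mul, Polynomial.eval_smul,
    Polynomial.eval_add, Polynomial.eval_mul, smul_eq_mul]
  set W := opMinor w v fun j => M + j.val
  set W' := opMinor w v fun j => M + 1 + j.val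
  set T := (nodePoly v).eval x
  set h := pairing w (monicOrthPoly w M) (monicOrthPoly w M)
  field_simp
  ring

lemma opeDensity_perm (w : ℝ → ℝ) (N : ℕ) (x : Fin N → ℕ) (σ : Equiv.Perm (Fin N)) :
    opeDensity w N (x ∘ σ) = opeDensity w N x := by
  rw [opeDensity_eq, opeDensity_eq]
  congr 1
  · have h := Matrix.det_permute' σ
      (Matrix.of fun i j : Fin N => (monicOrthPoly w i).eval (x j : ℝ))
    change (Matrix.of fun i j : Fin N => (monicOrthPoly w i).eval ((x ∘ σ) j : ℝ)).det = _ at h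
    rw [h, mul_pow, ← Int.cast_pow]
    simp [← Units.val_pow_eq_pow_val]
  · exact Equiv.prod_comp σ fun i => w (x i)

/-- The contribution of the ground state `{0, …, N-1}` to the partition function. -/
lemma opeDensity_ground_le (hw : AdmissibleWeight w) (N : ℕ) :
    opeDensity w N (fun i => i.val)
      ≤ ∏ n ∈ Finset.range N, pairing w (monicOrthPoly w n) (monicOrthPoly w n) := by
  have hinj : Function.Injective fun (σ : Equiv.Perm (Fin N)) (i : Fin N) => (σ i).val :=
    fun σ τ h => Equiv.ext fun i => Fin.ext (congrFun h i)
  have h := sum_le_hasSum (Finset.univ.map ⟨_, hinj⟩) (fun x _ => hw.opeDensity_nonneg N x)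
    (hw.hasSum_opeDensity N)
  -- the `N!` orderings of the ground state
  rw [Finset.sum_map] at h
  change ∑ σ : Equiv.Perm (Fin N), opeDensity w N ((fun i => i.val) ∘ σ) ≤ _ at h
  simp only [opeDensity_perm] at h
  rw [Finset.sum_const, Finset.card_univ, Fintype.card_perm, Fintype.card_fin, nsmul_eq_mul] at h
  exact le_of_mul_le_mul_left h (by exact_mod_cast N.factorial_pos)

lemma opeDensity_ground (w : ℝ → ℝ) (N : ℕ) :
    opeDensity w N (fun i => i.val)
      = ∏ n ∈ Finset.range N, ((n.factorial : ℝ) ^ 2 * w n) := by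
  rw [Finset.prod_mul_distrib, opeDensity, Fin.prod_univ_eq_prod_range (fun n => w (n : ℝ))]
  congr 1
  cases N with
  | zero => simp
  | succ N =>
    have h := Matrix.det_vandermonde_id_eq_superFactorial (R := ℝ) N
    rw [Matrix.det_vandermonde, ← Nat.prod_range_succ_factorial, Nat.cast_prod] at h
    rw [Finset.prod_pow, ← h]
    simp only [← Finset.prod_pow]
    exact Finset.prod_congr rfl fun i _ => Finset.prod_congr rfl fun j _ => by ring

/-- Lower bound for the confluent determinants of a deformed weight: their quotients are the
quotients of the partition functions, and the ground state bounds the deformed partition function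
from below. -/
lemma le_abs_opMinor (hw : AdmissibleWeight w) (hv : Function.Injective v)
    (hZ : ∀ i, ∀ n : ℕ, v i ≠ n) (N : ℕ) :
    |opMinor w v (fun j => j.val)| * (∏ n ∈ Finset.range N, (n.factorial : ℝ) ^ 2 * w n
        * (nodePoly v).eval (n : ℝ) / pairing w (monicOrthPoly w n) (monicOrthPoly w n))
      ≤ |opMinor w v (fun j => N + j.val)| := by
  have hw' := hw.christoffel hZ
  have hW : ∀ n, opMinor w v (fun j => n + j.val) ≠ 0 := hw.opMinor_ne_zero hv hZ
  have h0 : (fun j : Fin (2 * k) => 0 + j.val) = fun j => j.val := by simp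
  have htel : ∀ n, opMinor w v (fun j => n + j.val) = opMinor w v (fun j => j.val)
      * ∏ m ∈ Finset.range n, (pairing (christoffelWeight w v)
        (monicOrthPoly (christoffelWeight w v) m) (monicOrthPoly (christoffelWeight w v) m)
          / pairing w (monicOrthPoly w m) (monicOrthPoly w m)) := by
    intro n
    induction n with
    | zero => simp
    | succ n ih =>
      rw [Finset.prod_range_succ, ← mul_assoc, ← ih, hw.pairing_christoffelWeight hv hZ,
        mul_div_cancel_right₀ _ (hw.pairing_monicOrthPoly_pos n).ne', mul_div_cancel₀ _ (hW n)]
  rw [htel N, abs_mul]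
  refine mul_le_mul_of_nonneg_left ?_ (abs_nonneg _)
  refine le_trans ?_ (le_abs_self _)
  rw [Finset.prod_div_distrib, Finset.prod_div_distrib]
  refine div_le_div_of_nonneg_right ?_
    (Finset.prod_nonneg fun n _ => (hw.pairing_monicOrthPoly_pos n).le)
  refine le_trans (le_of_eq ?_) (hw'.opeDensity_ground_le N)
  rw [opeDensity_ground]
  exact Finset.prod_congr rfl fun n _ => by rw [christoffelWeight_eq]; ring

end AdmissibleWeight

/-! ### Charlier polynomials -/

lemma charlierWeight_natCast (a : ℝ) (n : ℕ) :
    charlierWeight a n = Real.exp (-a) * (a ^ n / n.factorial) := by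
  rw [charlierWeight, Real.rpow_natCast, Real.Gamma_nat_eq_factorial, mul_div_assoc]

lemma admissibleWeight_charlierWeight {a : ℝ} (ha : 0 < a) :
    AdmissibleWeight (charlierWeight a) where
  pos n := by
    rw [charlierWeight_natCast]
    positivity
  summable_pow m := by
    refine Summable.of_nonneg_of_le (fun n => ?_) (fun n => ?_)
      ((Real.summable_pow_div_factorial (Real.exp 1 * a)).mul_left
        (Real.exp (-a) * m.factorial))
    · rw [charlierWeight_natCast]
      positivity
    · have h := Real.pow_div_factorial_le_exp (n : ℝ) (Nat.cast_nonneg n) m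
      rw [div_le_iff₀ (by positivity), ← mul_one (n : ℝ), Real.exp_nat_mul, mul_one] at h
      rw [charlierWeight_natCast, mul_pow]
      calc (n : ℝ) ^ m * (Real.exp (-a) * (a ^ n / n.factorial))
          ≤ (Real.exp 1 ^ n * m.factorial) * (Real.exp (-a) * (a ^ n / n.factorial)) := by
            gcongr
        _ = _ := by ring

/-- The raising operator `Q ↦ x Q(x - 1) - a Q(x)` of the Charlier polynomials. -/
noncomputable def charlierRaise (a : ℝ) (Q : Polynomial ℝ) : Polynomial ℝ :=
  X * Q.comp (X - 1) - C a * Q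

/-- The monic Charlier polynomials with parameter `a`. -/
noncomputable def charlierPoly (a : ℝ) (n : ℕ) : Polynomial ℝ := (charlierRaise a)^[n] 1

lemma charlierPoly_zero (a : ℝ) : charlierPoly a 0 = 1 := rfl

lemma charlierPoly_succ (a : ℝ) (n : ℕ) :
    charlierPoly a (n + 1) = charlierRaise a (charlierPoly a n) :=
  Function.iterate_succ_apply' _ _ _

lemma charlierPoly_monic_natDegree (a : ℝ) (n : ℕ) :
    (charlierPoly a n).Monic ∧ (charlierPoly a n).natDegree = n := by
  induction n with
  | zero => simp [charlierPoly_zero]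
  | succ n ih =>
    have hm : (X * (charlierPoly a n).comp (X - 1)).Monic :=
      Polynomial.monic_X.mul (by simpa using ih.1.comp_X_sub_C (1 : ℝ))
    have hd : (X * (charlierPoly a n).comp (X - 1)).natDegree = n + 1 := by
      rw [Polynomial.natDegree_X_mul]
      · rw [Polynomial.natDegree_comp, ih.2]
        have : (X - 1 : Polynomial ℝ).natDegree = 1 := by
          simpa using Polynomial.natDegree_X_sub_C (1 : ℝ)
        rw [this, mul_one]
      · rintro h
        rw [h, mul_zero] at hm
        exact hm.ne_zero rfl
    have hlt : (C a * charlierPoly a n).degree < (X * (charlierPoly a n).comp (X - 1)).degree := by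
      rw [Polynomial.degree_eq_natDegree hm.ne_zero, hd, ← Polynomial.smul_eq_C_mul]
      refine (Polynomial.degree_smul_le _ _).trans_lt ?_
      rw [Polynomial.degree_eq_natDegree ih.1.ne_zero, ih.2]
      exact_mod_cast n.lt_succ_self
    rw [charlierPoly_succ, charlierRaise]
    exact ⟨hm.sub_of_left hlt, by
      rw [Polynomial.natDegree_eq_of_degree_eq (Polynomial.degree_sub_eq_left_of_degree_lt hlt),
        hd]⟩

/-- The forward difference lowers Charlier polynomials: `Δ C_n = n C_{n-1}`. -/
lemma charlierPoly_succ_diff (a : ℝ) (n : ℕ) :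
    (charlierPoly a (n + 1)).comp (X + 1) - charlierPoly a (n + 1)
      = (n + 1 : ℝ) • charlierPoly a n := by
  have hcomm : ∀ Q : Polynomial ℝ, (charlierRaise a Q).comp (X + 1) - charlierRaise a Q
      = charlierRaise a (Q.comp (X + 1) - Q) + Q := by
    intro Q
    refine Polynomial.funext fun x => ?_
    simp [charlierRaise, Polynomial.eval_comp]
    ring
  have hsmul : ∀ (b : ℝ) (Q : Polynomial ℝ), charlierRaise a (b • Q) = b • charlierRaise a Q := by
    intro b Q
    refine Polynomial.funext fun x => ?_
    simp [charlierRaise, Polynomial.eval_comp]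
    ring
  induction n with
  | zero =>
    rw [charlierPoly_succ, hcomm, charlierPoly_zero]
    simp [charlierRaise]
  | succ n ih =>
    rw [charlierPoly_succ a (n + 1), hcomm, ih, hsmul, ← charlierPoly_succ]
    push_cast
    module

/-- The raising operator is `a` times the adjoint of the forward difference. -/
lemma functional_charlierRaise_mul {a : ℝ} (ha : 0 < a) (Q R : Polynomial ℝ) :
    (admissibleWeight_charlierWeight ha).functional (charlierRaise a Q * R)
      = a * (admissibleWeight_charlierWeight ha).functional (Q * (R.comp (X + 1) - R)) := by
  set L := (admissibleWeight_charlierWeight ha).functional with hL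
  -- The Poisson weight satisfies `(n + 1) ω(n + 1) = a ω(n)`.
  have hshift : ∀ P : Polynomial ℝ, L (X * P.comp (X - 1)) = a * L P := by
    intro P
    change ∑' n : ℕ, (X * P.comp (X - 1)).eval (n : ℝ) * charlierWeight a n
      = a * ∑' n : ℕ, P.eval (n : ℝ) * charlierWeight a n
    rw [((admissibleWeight_charlierWeight ha).summable_eval (X * P.comp (X - 1))).tsum_eq_zero_add,
      ← tsum_mul_left]
    simp only [Polynomial.eval_mul, Polynomial.eval_X, Polynomial.eval_comp, Polynomial.eval_sub,
      Polynomial.eval_one, Nat.cast_zero, zero_mul, zero_add]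
    refine tsum_congr fun n => ?_
    rw [charlierWeight_natCast, charlierWeight_natCast, Nat.factorial_succ]
    push_cast
    have hn : (n : ℝ) + 1 ≠ 0 := by positivity
    rw [add_sub_cancel_right, pow_succ]
    field_simp
  have h1 : charlierRaise a Q * R = X * (Q * R.comp (X + 1)).comp (X - 1) - a • (Q * R) := by
    refine Polynomial.funext fun x => ?_
    simp [charlierRaise, Polynomial.eval_comp]
    ring
  rw [h1, map_sub, hshift, map_smul, mul_sub, map_sub, smul_eq_mul, mul_sub]

lemma functional_charlierPoly_mul {a : ℝ} (ha : 0 < a) (n m : ℕ) :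
    (admissibleWeight_charlierWeight ha).functional (charlierPoly a n * charlierPoly a m)
      = if n = m then a ^ n * n.factorial else 0 := by
  induction n generalizing m with
  | zero =>
    have h0 : (admissibleWeight_charlierWeight ha).functional 1 = 1 := by
      change ∑' n : ℕ, (1 : Polynomial ℝ).eval (n : ℝ) * charlierWeight a n = 1
      simp only [Polynomial.eval_one, one_mul, charlierWeight_natCast]
      rw [tsum_mul_left, ← congrFun NormedSpace.exp_eq_tsum_div a, ← Real.exp_eq_exp_ℝ,
        ← Real.exp_add]
      simp
    cases m with
    | zero => simp [charlierPoly_zero, h0]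
    | succ m =>
      rw [mul_comm, charlierPoly_succ, functional_charlierRaise_mul ha, charlierPoly_zero]
      simp
  | succ n ih =>
    rw [charlierPoly_succ, functional_charlierRaise_mul ha]
    cases m with
    | zero => simp [charlierPoly_zero]
    | succ m =>
      rw [charlierPoly_succ_diff, mul_smul_comm, map_smul, ih, smul_eq_mul]
      by_cases h : n = m
      · subst h
        simp only [if_true, Nat.factorial_succ]
        push_cast
        ring
      · simp [h]

lemma monicOrthPoly_charlierWeight {a : ℝ} (ha : 0 < a) (n : ℕ) :
    monicOrthPoly (charlierWeight a) n = charlierPoly a n := by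
  refine ((admissibleWeight_charlierWeight ha).eq_monicOrthPoly
    (charlierPoly_monic_natDegree a n).1 (charlierPoly_monic_natDegree a n).2 fun Q hQ => ?_).symm
  refine AdmissibleWeight.map_eq_zero_of_degree_lt (fun m => (charlierPoly_monic_natDegree a m).1)
    (fun m => (charlierPoly_monic_natDegree a m).2)
    ((admissibleWeight_charlierWeight ha).functional ∘ₗ
      LinearMap.mulLeft ℝ (charlierPoly a n)) (fun m hm => ?_) hQ
  exact (functional_charlierPoly_mul ha n m).trans (if_neg hm.ne')

lemma pairing_charlierWeight {a : ℝ} (ha : 0 < a) (n : ℕ) :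
    pairing (charlierWeight a) (monicOrthPoly (charlierWeight a) n)
      (monicOrthPoly (charlierWeight a) n) = a ^ n * n.factorial := by
  rw [monicOrthPoly_charlierWeight ha, (admissibleWeight_charlierWeight ha).pairing_eq,
    functional_charlierPoly_mul ha, if_pos rfl]

lemma one_div_Gamma_eq_mul (s : ℝ) : 1 / Real.Gamma s = s * (1 / Real.Gamma (s + 1)) := by
  rcases eq_or_ne s 0 with rfl | hs
  · simp
  · rw [Real.Gamma_add_one hs, one_div, one_div, mul_inv, mul_inv_cancel_left₀ hs]

/-- Falling factorials as quotients of Gamma functions. At the poles of `Γ(z - l + 1)` both sides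
are zero, since `Real.Gamma` takes the value `0` there. -/
lemma eval_descPochhammer {z : ℝ} (hz : Real.Gamma (z + 1) ≠ 0) (l : ℕ) :
    (descPochhammer ℝ l).eval z = Real.Gamma (z + 1) * (1 / Real.Gamma (z - l + 1)) := by
  induction l with
  | zero => simp [hz]
  | succ l ih =>
    rw [descPochhammer_succ_right, Polynomial.eval_mul, ih, Nat.cast_succ,
      show z - (l + 1) + 1 = z - l by ring, one_div_Gamma_eq_mul (z - l)]
    simp
    ring

lemma charlierPoly_eq_sum (a : ℝ) (n : ℕ) : charlierPoly a n
    = ∑ l ∈ Finset.range (n + 1), ((n.choose l : ℝ) * (-a) ^ l) • descPochhammer ℝ (n - l) := by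
  let A : Module.End ℝ (Polynomial ℝ) :=
    LinearMap.mulLeft ℝ X ∘ₗ (Polynomial.aeval (X - 1 : Polynomial ℝ)).toLinearMap
  have hA : ∀ Q, A Q = X * Q.comp (X - 1) := fun Q => by simp [A, Polynomial.comp_eq_aeval]
  have hAn : ∀ m, (A ^ m) 1 = descPochhammer ℝ m := by
    intro m
    induction m with
    | zero => simp
    | succ m ih => rw [pow_succ', Module.End.mul_apply, ih, hA, descPochhammer_succ_left]
  have hR : ∀ m, charlierPoly a m = (((-a) • (1 : Module.End ℝ (Polynomial ℝ)) + A) ^ m) 1 := by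
    intro m
    induction m with
    | zero => simp [charlierPoly_zero]
    | succ m ih =>
      rw [pow_succ', Module.End.mul_apply, ← ih, charlierPoly_succ, charlierRaise,
        LinearMap.add_apply, hA, LinearMap.smul_apply, Module.End.one_apply, neg_smul,
        Polynomial.smul_eq_C_mul]
      ring
  have hcomm : Commute ((-a) • (1 : Module.End ℝ (Polynomial ℝ))) A :=
    (Commute.one_left A).smul_left (-a)
  rw [hR, hcomm.add_pow, LinearMap.sum_apply]
  refine Finset.sum_congr rfl fun l _ => ?_
  rw [← hAn, smul_pow, one_pow, smul_mul_assoc, one_mul, ← nsmul_eq_mul', LinearMap.smul_apply,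
    LinearMap.smul_apply, ← Nat.cast_smul_eq_nsmul ℝ, smul_smul]

/-- Charlier polynomials in terms of the reciprocal Gamma function. -/
lemma eval_charlierPoly (a : ℝ) (n : ℕ) {z : ℝ} (hz : Real.Gamma (z + 1) ≠ 0) :
    (charlierPoly a n).eval z = Real.Gamma (z + 1) *
      ∑' l : ℕ, (n.choose l : ℝ) * (-a) ^ l / Real.Gamma (z - n + l + 1) := by
  rw [tsum_eq_sum (s := Finset.range (n + 1)), charlierPoly_eq_sum, Polynomial.eval_finsetSum,
    Finset.mul_sum]
  · refine Finset.sum_congr rfl fun l hl => ?_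
    rw [Polynomial.eval_smul, eval_descPochhammer hz,
      Nat.cast_sub (Nat.lt_succ_iff.1 (Finset.mem_range.1 hl)), smul_eq_mul,
      show z - ((n : ℝ) - l) + 1 = z - n + l + 1 by ring]
    ring
  · intro l hl
    rw [Finset.mem_range, not_lt] at hl
    rw [Nat.choose_eq_zero_of_lt (by omega)]
    simp

/-! ### Series in reciprocal Gamma functions -/

/-- The function `x ↦ ∑_l c_l / Γ(x + l + 1)`. The convention that `Real.Gamma` vanishes at its
poles makes the terms agree with the entire function `1/Γ` there. -/
noncomputable def gammaSeries (c : ℕ → ℝ) (x : ℝ) : ℝ := ∑' l : ℕ, c l / Real.Gamma (x + l + 1)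

/-- The entire function that extends `gammaSeries c`. -/
noncomputable def complexGammaSeries (c : ℕ → ℝ) (z : ℂ) : ℂ :=
  ∑' l : ℕ, (c l : ℂ) * (Complex.Gamma (z + l + 1))⁻¹

lemma complexGammaSeries_ofReal (c : ℕ → ℝ) (x : ℝ) :
    complexGammaSeries c x = gammaSeries c x := by
  rw [complexGammaSeries, gammaSeries, Complex.ofReal_tsum]
  refine tsum_congr fun l => ?_
  rw [div_eq_mul_inv, Complex.ofReal_mul, Complex.ofReal_inv, ← Complex.Gamma_ofReal]
  push_cast
  rfl

lemma differentiable_inv_Gamma_add (l : ℕ) :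
    Differentiable ℂ fun z : ℂ => (Complex.Gamma (z + l + 1))⁻¹ :=
  Complex.differentiable_one_div_Gamma.comp
    ((differentiable_id.add_const _).add_const _ : Differentiable ℂ fun z : ℂ => z + l + 1)

/-- `1 / Γ(z + l + 1)` is bounded on discs, uniformly in `l`: from `Γ(s + 1) = s Γ(s)`, it decreases
in `l` as soon as `|z + l + 1| ≥ 1`. -/
lemma exists_norm_inv_Gamma_le (R : ℝ) : ∃ B : ℝ, ∀ l : ℕ, ∀ z ∈ Metric.ball (0 : ℂ) R,
    ‖(Complex.Gamma (z + l + 1))⁻¹‖ ≤ B := by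
  have h1 : ∀ l : ℕ, ∃ b : ℝ, ∀ z ∈ Metric.closedBall (0 : ℂ) R,
      ‖(Complex.Gamma (z + l + 1))⁻¹‖ ≤ b := fun l =>
    (isCompact_closedBall (0 : ℂ) R).exists_bound_of_continuousOn
      (differentiable_inv_Gamma_add l).continuous.continuousOn
  choose b hb using h1
  set M := ⌈R⌉₊ with hM
  refine ⟨∑ l ∈ Finset.range (M + 1), |b l|, fun l z hz => ?_⟩
  have hz' : z ∈ Metric.closedBall (0 : ℂ) R := Metric.ball_subset_closedBall hz
  have hsmall : ∀ l ≤ M, ‖(Complex.Gamma (z + l + 1))⁻¹‖ ≤ ∑ l ∈ Finset.range (M + 1), |b l| :=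
    fun l hl => ((hb l z hz').trans (le_abs_self _)).trans
      (Finset.single_le_sum (f := fun l => |b l|) (fun _ _ => abs_nonneg _)
        (Finset.mem_range.2 (Nat.lt_succ_of_le hl)))
  rcases le_total l M with hl | hl
  · exact hsmall l hl
  · induction l, hl using Nat.le_induction with
    | base => exact hsmall M le_rfl
    | succ l hl ih =>
      refine le_trans ?_ ih
      have hre : 1 ≤ ‖z + l + 1‖ := by
        refine le_trans ?_ ((le_abs_self _).trans (Complex.abs_re_le_norm _))
        have h2 : -R ≤ z.re := by
          have h3 := (abs_le.1 (Complex.abs_re_le_norm z)).1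
          have h4 : ‖z‖ ≤ R := by simpa using hz'
          linarith
        have h5 : R ≤ (l : ℝ) := (Nat.le_ceil R).trans (by exact_mod_cast hl)
        simp
        linarith
      rw [Complex.one_div_Gamma_eq_self_mul_one_div_Gamma_add_one (z + l + 1), norm_mul]
      push_cast
      rw [show z + ((l : ℂ) + 1) + 1 = z + l + 1 + 1 by ring]
      exact le_mul_of_one_le_left (norm_nonneg _) hre

lemma differentiable_complexGammaSeries {c : ℕ → ℝ} (hc : Summable fun l => |c l|) :
    Differentiable ℂ (complexGammaSeries c) := by
  intro z
  obtain ⟨B, hB⟩ := exists_norm_inv_Gamma_le (‖z‖ + 1)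
  have h := Complex.differentiableOn_tsum_of_summable_norm (U := Metric.ball (0 : ℂ) (‖z‖ + 1))
    (F := fun l (z : ℂ) => (c l : ℂ) * (Complex.Gamma (z + l + 1))⁻¹) (hc.mul_right B)
    (fun l => ((differentiable_inv_Gamma_add l).const_mul _).differentiableOn) Metric.isOpen_ball
    (fun l w hw => by
      rw [norm_mul, Complex.norm_real, Real.norm_eq_abs]
      exact mul_le_mul_of_nonneg_left (hB l w hw) (abs_nonneg _))
  exact (h z (by simp)).differentiableAt (Metric.isOpen_ball.mem_nhds (by simp))

lemma summable_complexGammaSeries {c : ℕ → ℝ} (hc : Summable fun l => |c l|) (z : ℂ) :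
    Summable fun l : ℕ => (c l : ℂ) * (Complex.Gamma (z + l + 1))⁻¹ := by
  obtain ⟨B, hB⟩ := exists_norm_inv_Gamma_le (‖z‖ + 1)
  refine Summable.of_norm_bounded (hc.mul_right B) fun l => ?_
  rw [norm_mul, Complex.norm_real, Real.norm_eq_abs]
  exact mul_le_mul_of_nonneg_left (hB l z (by simp)) (abs_nonneg _)

/-- Convergence of the coefficients in `ℓ¹` gives locally uniform convergence of the series. -/
lemma tendstoLocallyUniformlyOn_complexGammaSeries {c : ℕ → ℕ → ℝ} {c' : ℕ → ℝ}
    (hc : ∀ᶠ N in atTop, Summable fun l => |c N l|) (hc' : Summable fun l => |c' l|)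
    (h : Tendsto (fun N => ∑' l, |c N l - c' l|) atTop (𝓝 0)) (R : ℝ) :
    TendstoLocallyUniformlyOn (fun N => complexGammaSeries (c N)) (complexGammaSeries c') atTop
      (Metric.ball 0 R) := by
  obtain ⟨B, hB⟩ := exists_norm_inv_Gamma_le R
  refine TendstoUniformlyOn.tendstoLocallyUniformlyOn
    (Metric.tendstoUniformlyOn_iff.2 fun ε hε => ?_)
  have h2 : Tendsto (fun N => (∑' l, |c N l - c' l|) * B) atTop (𝓝 0) := by
    simpa using h.mul_const B
  filter_upwards [hc, h2.eventually_lt_const hε] with N hN hlt z hz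
  refine lt_of_le_of_lt ?_ hlt
  have hs : Summable fun l => |c N l - c' l| :=
    Summable.of_nonneg_of_le (fun _ => abs_nonneg _) (fun l => abs_sub _ _) (hN.add hc')
  rw [dist_comm, dist_eq_norm, complexGammaSeries, complexGammaSeries,
    ← (summable_complexGammaSeries hN z).tsum_sub (summable_complexGammaSeries hc' z),
    ← tsum_mul_right]
  refine tsum_of_norm_bounded (hs.mul_right B).hasSum fun l => ?_
  rw [← sub_mul, norm_mul, ← Complex.ofReal_sub, Complex.norm_real, Real.norm_eq_abs]
  exact mul_le_mul_of_nonneg_left (hB l z hz) (abs_nonneg _)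

lemma hasDerivAt_gammaSeries' {c : ℕ → ℝ} (hc : Summable fun l => |c l|) (x : ℝ) :
    HasDerivAt (gammaSeries c) (deriv (complexGammaSeries c) x).re x := by
  have h := (differentiable_complexGammaSeries hc x).hasDerivAt.real_of_complex
  simpa only [complexGammaSeries_ofReal, Complex.ofReal_re] using h

lemma differentiable_gammaSeries {c : ℕ → ℝ} (hc : Summable fun l => |c l|) :
    Differentiable ℝ (gammaSeries c) := fun x => (hasDerivAt_gammaSeries' hc x).differentiableAt

lemma tendsto_gammaSeries {c : ℕ → ℕ → ℝ} {c' : ℕ → ℝ}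
    (hc : ∀ᶠ N in atTop, Summable fun l => |c N l|) (hc' : Summable fun l => |c' l|)
    (h : Tendsto (fun N => ∑' l, |c N l - c' l|) atTop (𝓝 0)) (x : ℝ) :
    Tendsto (fun N => gammaSeries (c N) x) atTop (𝓝 (gammaSeries c' x)) := by
  have h1 := (tendstoLocallyUniformlyOn_complexGammaSeries hc hc' h (|x| + 1)).tendsto_at
    (a := (x : ℂ)) (by simp)
  have h2 := (Complex.continuous_re.tendsto _).comp h1
  simpa only [Function.comp_def, complexGammaSeries_ofReal, Complex.ofReal_re] using h2

lemma tendsto_deriv_gammaSeries {c : ℕ → ℕ → ℝ} {c' : ℕ → ℝ}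
    (hc : ∀ᶠ N in atTop, Summable fun l => |c N l|) (hc' : Summable fun l => |c' l|)
    (h : Tendsto (fun N => ∑' l, |c N l - c' l|) atTop (𝓝 0)) (x : ℝ) :
    Tendsto (fun N => deriv (gammaSeries (c N)) x) atTop (𝓝 (deriv (gammaSeries c') x)) := by
  have h1 := ((tendstoLocallyUniformlyOn_complexGammaSeries hc hc' h (|x| + 1)).deriv
    (hc.mono fun N hN => (differentiable_complexGammaSeries hN).differentiableOn)
    Metric.isOpen_ball).tendsto_at (a := (x : ℂ)) (by simp)
  have h2 := (Complex.continuous_re.tendsto _).comp h1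
  rw [(hasDerivAt_gammaSeries' hc' x).deriv]
  refine h2.congr' (hc.mono fun N hN => ?_)
  exact (hasDerivAt_gammaSeries' hN x).deriv.symm

/-! ### Bessel functions in the order variable -/

/-- The coefficients `(-α)^l / l!`, for which `gammaSeries` is `ν ↦ α^{-ν/2} J_ν(2√α)`. -/
noncomputable def besselCoeff (α : ℝ) (l : ℕ) : ℝ := (-α) ^ l / l.factorial

lemma summable_besselCoeff (α : ℝ) : Summable fun l => |besselCoeff α l| := by
  simpa [besselCoeff, abs_div, abs_pow] using Real.summable_pow_div_factorial |α|

lemma besselJ_eq {α : ℝ} (hα : 0 < α) (ν : ℝ) :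
    besselJ ν (2 * √α) = α ^ (ν / 2) * gammaSeries (besselCoeff α) ν := by
  rw [besselJ, gammaSeries, ← tsum_mul_left]
  refine tsum_congr fun m => ?_
  rw [mul_div_cancel_left₀ _ (two_ne_zero), Real.sqrt_eq_rpow, ← Real.rpow_mul hα.le,
    show (1 / 2 : ℝ) * (2 * m + ν) = ν / 2 + m by ring, Real.rpow_add hα, Real.rpow_natCast,
    besselCoeff, show (m : ℝ) + ν + 1 = ν + m + 1 by ring, neg_pow α]
  field_simp

lemma hasDerivAt_rpow_half {α : ℝ} (hα : 0 < α) (ν : ℝ) :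
    HasDerivAt (fun μ : ℝ => α ^ (μ / 2)) (α ^ (ν / 2) * (Real.log α / 2)) ν :=
  (((hasDerivAt_id' ν).div_const 2).const_rpow hα).congr_deriv (by ring)

lemma hasDerivAt_besselJ {α : ℝ} (hα : 0 < α) (ν : ℝ) :
    HasDerivAt (fun μ => besselJ μ (2 * √α)) (α ^ (ν / 2) * (Real.log α / 2)
      * gammaSeries (besselCoeff α) ν + α ^ (ν / 2) * deriv (gammaSeries (besselCoeff α)) ν) ν := by
  have h2 := ((differentiable_gammaSeries (summable_besselCoeff α)) ν).hasDerivAt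
  simp only [besselJ_eq hα]
  exact (hasDerivAt_rpow_half hα ν).mul h2

lemma besselL_eq {α : ℝ} (hα : 0 < α) (ν : ℝ) :
    besselL ν (2 * √α) = α ^ (ν / 2) * (Real.log α / 2) * gammaSeries (besselCoeff α) ν
      + α ^ (ν / 2) * deriv (gammaSeries (besselCoeff α)) ν :=
  (hasDerivAt_besselJ hα ν).deriv

/-! ### Asymptotics of Charlier polynomials and Gamma functions -/

/-- The coefficients `binom(m, l) (-a)^l` of a Charlier polynomial. -/
noncomputable def charlierCoeff (a : ℝ) (m l : ℕ) : ℝ := (m.choose l : ℝ) * (-a) ^ l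

lemma summable_charlierCoeff (a : ℝ) (m : ℕ) : Summable fun l => |charlierCoeff a m l| := by
  refine summable_of_ne_finset_zero (s := Finset.range (m + 1)) fun l hl => ?_
  rw [Finset.mem_range, not_lt] at hl
  rw [charlierCoeff, Nat.choose_eq_zero_of_lt (by omega)]
  simp

lemma tendsto_choose_div_pow {m : ℕ → ℕ} {d : ℝ} (hm : ∀ᶠ N : ℕ in atTop, (m N : ℝ) = N + d)
    (l : ℕ) : Tendsto (fun N : ℕ => ((m N).choose l : ℝ) / (N : ℝ) ^ l) atTop
      (𝓝 (1 / l.factorial)) := by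
  induction l with
  | zero => simp
  | succ l ih =>
    have h1 : Tendsto (fun N : ℕ => (1 + (d - l) / (N : ℝ)) / (l + 1)) atTop (𝓝 (1 / (l + 1))) := by
      have := (tendsto_const_div_atTop_nhds_zero_nat (d - l)).const_add 1
      simpa using this.div_const ((l : ℝ) + 1)
    have h2 := ih.mul h1
    rw [Nat.factorial_succ, Nat.cast_mul, mul_comm ((l + 1 : ℕ) : ℝ), ← one_div_mul_one_div]
    push_cast
    refine h2.congr' ?_
    filter_upwards [hm, eventually_gt_atTop 0, (tendsto_natCast_atTop_atTop.eventually_ge_atTop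
      ((l : ℝ) - d))] with N hN hN0 hNl
    have hlm : l ≤ m N := by
      have : (l : ℝ) ≤ m N := by rw [hN]; linarith
      exact_mod_cast this
    have h3 : ((m N).choose (l + 1) : ℝ) * (l + 1) = (m N).choose l * (N + d - l) := by
      rw [← hN, ← Nat.cast_sub hlm]
      exact_mod_cast Nat.choose_succ_right_eq (m N) l
    have hN' : (N : ℝ) ≠ 0 := by positivity
    rw [pow_succ]
    field_simp
    rw [mul_comm ((l : ℝ) + 1), h3]
    ring

/-- The coefficients of Charlier polynomials of degree `N + d` and parameter `α / N` converge in
`ℓ¹` to those of the Bessel function. -/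
lemma tendsto_charlierCoeff {α : ℝ} (hα : 0 < α) {m : ℕ → ℕ} {d : ℝ}
    (hm : ∀ᶠ N : ℕ in atTop, (m N : ℝ) = N + d) :
    Tendsto (fun N : ℕ => ∑' l, |charlierCoeff (α / N) (m N) l - besselCoeff α l|) atTop
      (𝓝 0) := by
  -- dominated convergence, from `binom(m, l) ≤ m^l / l!` and `m ≤ N (1 + |d|)`
  have hsum : Summable fun l : ℕ => (α * (1 + |d|)) ^ l / (l.factorial : ℝ) + |besselCoeff α l| :=
    (Real.summable_pow_div_factorial _).add (summable_besselCoeff α)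
  have h := tendsto_tsum_of_dominated_convergence (𝓕 := atTop)
    (f := fun (N : ℕ) l => |charlierCoeff (α / N) (m N) l - besselCoeff α l|)
    (g := fun _ => (0 : ℝ)) hsum (fun l => ?_) ?_
  · simpa using h
  · have h1 : Tendsto (fun N : ℕ => charlierCoeff (α / N) (m N) l) atTop
        (𝓝 (besselCoeff α l)) := by
      have h2 := (tendsto_choose_div_pow hm l).mul_const ((-α) ^ l)
      rw [besselCoeff, div_eq_mul_one_div, mul_comm]
      refine h2.congr fun N => ?_
      rw [charlierCoeff, ← neg_div, div_pow]
      ring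
    have h2 := (h1.sub_const (besselCoeff α l)).abs
    simpa using h2
  · filter_upwards [hm, eventually_gt_atTop 0] with N hN hN0 l
    have hN' : (0 : ℝ) < N := by positivity
    have hmle : (m N : ℝ) ≤ N * (1 + |d|) := by
      have h1 : (1 : ℝ) ≤ N := by exact_mod_cast hN0
      have h2 := le_abs_self d
      have h3 := abs_nonneg d
      rw [hN]
      nlinarith
    rw [Real.norm_eq_abs, abs_abs]
    refine (abs_sub _ _).trans (add_le_add_left ?_ _)
    rw [charlierCoeff, abs_mul, abs_pow, abs_neg, abs_of_pos (by positivity : 0 < α / N),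
      Nat.abs_cast]
    calc ((m N).choose l : ℝ) * (α / N) ^ l
        ≤ (m N : ℝ) ^ l / l.factorial * (α / N) ^ l := by
          gcongr
          exact Nat.choose_le_pow_div l (m N)
      _ ≤ (N * (1 + |d|)) ^ l / l.factorial * (α / N) ^ l := by gcongr
      _ = (α * (1 + |d|)) ^ l / l.factorial := by
          rw [div_mul_eq_mul_div, ← mul_pow]
          congr 2
          field_simp

/-- `Γ(N + x + 1) ∼ N! N^x`: for `x > 0` this is Euler's limit formula, and the functional equation
extends it to all real `x`. -/
lemma tendsto_Gamma_div (x : ℝ) : Tendsto (fun N : ℕ =>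
    Real.Gamma (x + N + 1) / (N.factorial * (N : ℝ) ^ x)) atTop (𝓝 1) := by
  have hpos : ∀ x : ℝ, 0 < x → Tendsto (fun N : ℕ =>
      Real.Gamma (x + N + 1) / (N.factorial * (N : ℝ) ^ x)) atTop (𝓝 1) := by
    intro x hx
    have hG := (Real.Gamma_pos_of_pos hx).ne'
    have h1 := (tendsto_const_nhds (x := Real.Gamma x)).div (Real.GammaSeq_tendsto_Gamma x) hG
    rw [div_self hG] at h1
    refine h1.congr' ?_
    filter_upwards [eventually_gt_atTop 0] with N hN
    have hN' : (0 : ℝ) < N := by positivity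
    have hprod : ∀ n : ℕ, Real.Gamma (x + n) = (∏ j ∈ Finset.range n, (x + j)) * Real.Gamma x := by
      intro n
      induction n with
      | zero => simp
      | succ n ih =>
        rw [Nat.cast_succ, ← add_assoc, Real.Gamma_add_one (by positivity), ih,
          Finset.prod_range_succ]
        ring
    have h2 := hprod (N + 1)
    rw [Nat.cast_succ, ← add_assoc] at h2
    rw [h2, Pi.div_apply, Real.GammaSeq]
    have h3 : ∏ j ∈ Finset.range (N + 1), (x + (j : ℝ)) ≠ 0 :=
      Finset.prod_ne_zero_iff.2 fun j _ => by positivity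
    have h4 : (N : ℝ) ^ x ≠ 0 := (Real.rpow_pos_of_pos hN' x).ne'
    field_simp
  have hstep : ∀ (n : ℕ) (x : ℝ), 0 < x + n → Tendsto (fun N : ℕ =>
      Real.Gamma (x + N + 1) / (N.factorial * (N : ℝ) ^ x)) atTop (𝓝 1) := by
    intro n
    induction n with
    | zero => intro x hx; exact hpos x (by simpa using hx)
    | succ n ih =>
      intro x hx
      have h1 := ih (x + 1) (by push_cast at hx; linarith)
      have h2 : Tendsto (fun N : ℕ => 1 / (1 + (x + 1) / (N : ℝ))) atTop (𝓝 1) := by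
        have h3 := (tendsto_const_div_atTop_nhds_zero_nat (x + 1)).const_add 1
        rw [add_zero] at h3
        have h4 := (tendsto_const_nhds (x := (1 : ℝ))).div h3 one_ne_zero
        rwa [div_one] at h4
      have h4 := h1.mul h2
      rw [mul_one] at h4
      refine h4.congr' ?_
      filter_upwards [eventually_gt_atTop 0,
        (tendsto_natCast_atTop_atTop.eventually_gt_atTop (-x - 1))] with N hN hNx
      have hN' : (0 : ℝ) < N := by positivity
      have h5 : x + N + 1 ≠ 0 := by
        have : 0 < x + N + 1 := by linarith
        exact this.ne'
      rw [show x + 1 + N + 1 = x + N + 1 + 1 by ring, Real.Gamma_add_one h5,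
        Real.rpow_add_one hN'.ne']
      have h6 : (N : ℝ) ^ x ≠ 0 := (Real.rpow_pos_of_pos hN' x).ne'
      have h7 : 1 + (x + 1) / (N : ℝ) = (x + N + 1) / N := by field_simp; ring
      rw [h7]
      field_simp
  obtain ⟨n, hn⟩ := exists_nat_gt (-x)
  exact hstep n x (by linarith)

/-! ### Scaled confluent determinants and their limits -/

lemma borderedDet_add_mul {k : ℕ} (f g : Fin (2 * k + 1) → Fin k → ℝ) (v v' : Fin (2 * k + 1) → ℝ)
    (r r' : ℝ) : borderedDet f g (fun j => r * v j + r' * v' j)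
      = r * borderedDet f g v + r' * borderedDet f g v' := by
  simp only [borderedDet_eq_sum, Finset.mul_sum, ← Finset.sum_add_distrib]
  exact Finset.sum_congr rfl fun j _ => by ring

/-- The Charlier polynomial of degree `m` and parameter `α / N` at `x + N`, divided by
`Γ(x + N + 1)`; it is entire in `x`. -/
noncomputable def scaledCharlier (α : ℝ) (N m : ℕ) (x : ℝ) : ℝ :=
  gammaSeries (charlierCoeff (α / N) m) (x + (N - m))

/-- The derivative of `scaledCharlier` in `x`. -/
noncomputable def scaledCharlierDeriv (α : ℝ) (N m : ℕ) (x : ℝ) : ℝ :=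
  deriv (gammaSeries (charlierCoeff (α / N) m)) (x + (N - m))

lemma eval_charlierPoly_scaled {α : ℝ} {N : ℕ} (m : ℕ) {x : ℝ}
    (hx : Real.Gamma (x + N + 1) ≠ 0) :
    (charlierPoly (α / N) m).eval (x + N)
      = Real.Gamma (x + N + 1) * scaledCharlier α N m x := by
  rw [eval_charlierPoly _ _ hx, scaledCharlier, gammaSeries, ← add_sub_assoc]
  rfl

lemma Gamma_ne_neg {x : ℝ} (hx : Real.Gamma x ≠ 0) (m : ℕ) : x ≠ -m := by
  rintro rfl
  exact hx (Real.Gamma_neg_nat_eq_zero m)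

lemma eval_derivative_charlierPoly_scaled {α : ℝ} {N : ℕ} (m : ℕ) {x : ℝ}
    (hx : Real.Gamma (x + N + 1) ≠ 0) :
    (charlierPoly (α / N) m).derivative.eval (x + N)
      = deriv Real.Gamma (x + N + 1) * scaledCharlier α N m x
        + Real.Gamma (x + N + 1) * scaledCharlierDeriv α N m x := by
  have hΓ : DifferentiableAt ℝ Real.Gamma (x + N + 1) :=
    Real.differentiableAt_Gamma (Gamma_ne_neg hx)
  have h1 : HasDerivAt (fun y : ℝ => Real.Gamma (y + N + 1)) (deriv Real.Gamma (x + N + 1)) x :=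
    (hΓ.hasDerivAt.comp_add_const (x + N) 1).comp_add_const x N
  have h2 : HasDerivAt (scaledCharlier α N m) (scaledCharlierDeriv α N m x) x :=
    (differentiable_gammaSeries (summable_charlierCoeff (α / N) m)
      (x + (N - m))).hasDerivAt.comp_add_const x (N - m : ℝ)
  have h3 : HasDerivAt (fun y : ℝ => (charlierPoly (α / N) m).eval (y + N))
      ((charlierPoly (α / N) m).derivative.eval (x + N)) x :=
    ((charlierPoly (α / N) m).hasDerivAt (x + N)).comp_add_const x N
  refine h3.unique ((h1.mul h2).congr_of_eventuallyEq ?_)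
  filter_upwards [h1.continuousAt.eventually_ne hx] with y hy
  exact eval_charlierPoly_scaled m hy

variable {α : ℝ} {k : ℕ} {u : Fin k → ℝ}

/-- The confluent determinant of the orthogonal polynomials of degrees `n, …, n + 2k - 1`, without
its Gamma factors. -/
noncomputable def scaledMinor (α : ℝ) (u : Fin k → ℝ) (N n : ℕ) : ℝ :=
  confluentDet (fun (j : Fin (2 * k)) i => scaledCharlier α N (n + j.val) (u i))
    fun j i => scaledCharlierDeriv α N (n + j.val) (u i)

/-- Christoffel's determinant at `x + N` without its Gamma factors. -/
noncomputable def scaledChristoffel (α : ℝ) (u : Fin k → ℝ) (N n : ℕ) (x : ℝ) : ℝ :=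
  borderedDet (fun (j : Fin (2 * k + 1)) i => scaledCharlier α N (n + j.val) (u i))
    (fun j i => scaledCharlierDeriv α N (n + j.val) (u i))
    fun j => scaledCharlier α N (n + j.val) x

/-- The derivative of `scaledChristoffel` in `x`. -/
noncomputable def scaledChristoffelDeriv (α : ℝ) (u : Fin k → ℝ) (N n : ℕ) (x : ℝ) : ℝ :=
  borderedDet (fun (j : Fin (2 * k + 1)) i => scaledCharlier α N (n + j.val) (u i))
    (fun j i => scaledCharlierDeriv α N (n + j.val) (u i))
    fun j => scaledCharlierDeriv α N (n + j.val) x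

lemma Gamma_node_ne_zero (hZ : ∀ (i : Fin k) (m : ℤ), u i ≠ m) (N : ℕ) (i : Fin k) :
    Real.Gamma (u i + N + 1) ≠ 0 := by
  refine Real.Gamma_ne_zero fun m h => hZ i (-m - N - 1) ?_
  push_cast
  linarith

lemma node_ne_natCast (hZ : ∀ (i : Fin k) (m : ℤ), u i ≠ m) (N : ℕ) (i : Fin k) (n : ℕ) :
    u i + N ≠ n := by
  intro h
  refine hZ i (n - N) ?_
  push_cast
  linarith

/-- The derivatives of the Gamma factors contribute multiples of the rows of values, so they drop
out. -/
lemma opMinor_charlierWeight (hα : 0 < α) (hZ : ∀ (i : Fin k) (m : ℤ), u i ≠ m) {N : ℕ}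
    (hN : 0 < N) (n : ℕ) :
    opMinor (charlierWeight (α / N)) (fun i => u i + N) (fun j => n + j.val)
      = (∏ i, Real.Gamma (u i + N + 1)) ^ 2 * scaledMinor α u N n := by
  have ha : 0 < α / N := by positivity
  rw [opMinor, scaledMinor, ← confluentDet_leibniz _ _ _
    fun i => deriv Real.Gamma (u i + N + 1)]
  simp only [monicOrthPoly_charlierWeight ha,
    eval_charlierPoly_scaled _ (Gamma_node_ne_zero hZ N _),
    eval_derivative_charlierPoly_scaled _ (Gamma_node_ne_zero hZ N _)]

lemma eval_christoffelPoly_charlierWeight (hα : 0 < α) (hZ : ∀ (i : Fin k) (m : ℤ), u i ≠ m)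
    {N : ℕ} (hN : 0 < N) (n : ℕ) {x : ℝ} (hx : Real.Gamma (x + N + 1) ≠ 0) :
    (christoffelPoly (charlierWeight (α / N)) (fun i => u i + N) n).eval (x + N)
      = (∏ i, Real.Gamma (u i + N + 1)) ^ 2 * Real.Gamma (x + N + 1)
        * scaledChristoffel α u N n x := by
  have ha : 0 < α / N := by positivity
  have h := borderedDet_scale (fun (j : Fin (2 * k + 1)) i => scaledCharlier α N (n + j.val) (u i))
    (fun j i => scaledCharlierDeriv α N (n + j.val) (u i))
    (fun j => scaledCharlier α N (n + j.val) x) (fun i => Real.Gamma (u i + N + 1))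
    (fun i => deriv Real.Gamma (u i + N + 1)) (fun _ => 1) (Real.Gamma (x + N + 1))
  simp only [one_mul, Finset.prod_const_one] at h
  rw [eval_christoffelPoly, scaledChristoffel, ← h]
  simp only [monicOrthPoly_charlierWeight ha, eval_charlierPoly_scaled _ hx,
    eval_charlierPoly_scaled _ (Gamma_node_ne_zero hZ N _),
    eval_derivative_charlierPoly_scaled _ (Gamma_node_ne_zero hZ N _)]

lemma eval_derivative_christoffelPoly_charlierWeight (hα : 0 < α)
    (hZ : ∀ (i : Fin k) (m : ℤ), u i ≠ m) {N : ℕ} (hN : 0 < N) (n : ℕ) {x : ℝ}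
    (hx : Real.Gamma (x + N + 1) ≠ 0) :
    (christoffelPoly (charlierWeight (α / N)) (fun i => u i + N) n).derivative.eval (x + N)
      = (∏ i, Real.Gamma (u i + N + 1)) ^ 2 * (deriv Real.Gamma (x + N + 1)
        * scaledChristoffel α u N n x
          + Real.Gamma (x + N + 1) * scaledChristoffelDeriv α u N n x) := by
  have ha : 0 < α / N := by positivity
  have h := borderedDet_scale (fun (j : Fin (2 * k + 1)) i => scaledCharlier α N (n + j.val) (u i))
    (fun j i => scaledCharlierDeriv α N (n + j.val) (u i))
    (fun j => deriv Real.Gamma (x + N + 1) * scaledCharlier α N (n + j.val) x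
      + Real.Gamma (x + N + 1) * scaledCharlierDeriv α N (n + j.val) x)
    (fun i => Real.Gamma (u i + N + 1))
    (fun i => deriv Real.Gamma (u i + N + 1)) (fun _ => 1) 1
  rw [borderedDet_add_mul] at h
  simp only [one_mul, Finset.prod_const_one, mul_one] at h
  rw [eval_derivative_christoffelPoly, scaledChristoffel, scaledChristoffelDeriv, ← h]
  simp only [monicOrthPoly_charlierWeight ha,
    eval_charlierPoly_scaled _ (Gamma_node_ne_zero hZ N _),
    eval_derivative_charlierPoly_scaled _ hx,
    eval_derivative_charlierPoly_scaled _ (Gamma_node_ne_zero hZ N _)]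

lemma tendsto_scaledCharlier (hα : 0 < α) {m : ℕ → ℕ} {d : ℝ}
    (hm : ∀ᶠ N : ℕ in atTop, (m N : ℝ) = N - d) (x : ℝ) :
    Tendsto (fun N => scaledCharlier α N (m N) x) atTop
      (𝓝 (gammaSeries (besselCoeff α) (x + d))) := by
  have h := tendsto_gammaSeries (Eventually.of_forall fun N =>
    summable_charlierCoeff (α / N) (m N)) (summable_besselCoeff α)
    (tendsto_charlierCoeff hα (hm.mono fun N hN => hN.trans (sub_eq_add_neg _ _))) (x + d)
  refine h.congr' (hm.mono fun N hN => ?_)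
  change _ = gammaSeries _ (x + (N - m N))
  rw [hN, sub_sub_cancel]

lemma tendsto_scaledCharlierDeriv (hα : 0 < α) {m : ℕ → ℕ} {d : ℝ}
    (hm : ∀ᶠ N : ℕ in atTop, (m N : ℝ) = N - d) (x : ℝ) :
    Tendsto (fun N => scaledCharlierDeriv α N (m N) x) atTop
      (𝓝 (deriv (gammaSeries (besselCoeff α)) (x + d))) := by
  have h := tendsto_deriv_gammaSeries (Eventually.of_forall fun N =>
    summable_charlierCoeff (α / N) (m N)) (summable_besselCoeff α)
    (tendsto_charlierCoeff hα (hm.mono fun N hN => hN.trans (sub_eq_add_neg _ _))) (x + d)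
  refine h.congr' (hm.mono fun N hN => ?_)
  change _ = deriv (gammaSeries _) (x + (N - m N))
  rw [hN, sub_sub_cancel]

/-- The limit of `scaledMinor`: the determinant `C_k` without its powers of `α`. -/
noncomputable def limitMinor (α : ℝ) (u : Fin k → ℝ) : ℝ :=
  confluentDet (fun (j : Fin (2 * k)) i => gammaSeries (besselCoeff α) (u i - j.val))
    fun j i => deriv (gammaSeries (besselCoeff α)) (u i - j.val)

/-- The limit of `scaledChristoffel`: the determinant `A_{k,p}(x)` without its powers of `α`. -/
noncomputable def limitChristoffel (α : ℝ) (u : Fin k → ℝ) (p : ℕ) (x : ℝ) : ℝ :=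
  borderedDet (fun (j : Fin (2 * k + 1)) i => gammaSeries (besselCoeff α) (u i + p - j.val))
    (fun j i => deriv (gammaSeries (besselCoeff α)) (u i + p - j.val))
    fun j => gammaSeries (besselCoeff α) (x + p - j.val)

/-- The derivative of `limitChristoffel` in `x`. -/
noncomputable def limitChristoffelDeriv (α : ℝ) (u : Fin k → ℝ) (p : ℕ) (x : ℝ) : ℝ :=
  borderedDet (fun (j : Fin (2 * k + 1)) i => gammaSeries (besselCoeff α) (u i + p - j.val))
    (fun j i => deriv (gammaSeries (besselCoeff α)) (u i + p - j.val))
    fun j => deriv (gammaSeries (besselCoeff α)) (x + p - j.val)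

lemma eventually_degree_eq (p j : ℕ) :
    ∀ᶠ N : ℕ in atTop, ((N - p + j : ℕ) : ℝ) = N - (p - j : ℝ) := by
  filter_upwards [eventually_ge_atTop p] with N hN
  rw [Nat.cast_add, Nat.cast_sub hN]
  ring

lemma tendsto_scaledMinor (hα : 0 < α) (u : Fin k → ℝ) :
    Tendsto (fun N => scaledMinor α u N N) atTop (𝓝 (limitMinor α u)) := by
  have h : ∀ j : ℕ, ∀ᶠ N : ℕ in atTop, ((N + j : ℕ) : ℝ) = N - (-j : ℝ) := fun j =>
    Eventually.of_forall fun N => by push_cast; ring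
  refine tendsto_confluentDet (fun j i => ?_) fun j i => ?_
  · exact tendsto_scaledCharlier hα (h j.val) (u i)
  · exact tendsto_scaledCharlierDeriv hα (h j.val) (u i)

/-- Lowering the degree by `p` shifts the order of the Bessel functions up by `p`. -/
lemma tendsto_scaledChristoffel (hα : 0 < α) (u : Fin k → ℝ) (p : ℕ) (x : ℝ) :
    Tendsto (fun N => scaledChristoffel α u N (N - p) x) atTop
      (𝓝 (limitChristoffel α u p x)) := by
  simp only [limitChristoffel, add_sub_assoc]
  exact tendsto_borderedDet
    (fun j i => tendsto_scaledCharlier hα (eventually_degree_eq p j.val) (u i))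
    (fun j i => tendsto_scaledCharlierDeriv hα (eventually_degree_eq p j.val) (u i))
    fun j => tendsto_scaledCharlier hα (eventually_degree_eq p j.val) x

lemma tendsto_scaledChristoffelDeriv (hα : 0 < α) (u : Fin k → ℝ) (p : ℕ) (x : ℝ) :
    Tendsto (fun N => scaledChristoffelDeriv α u N (N - p) x) atTop
      (𝓝 (limitChristoffelDeriv α u p x)) := by
  simp only [limitChristoffelDeriv, add_sub_assoc]
  exact tendsto_borderedDet
    (fun j i => tendsto_scaledCharlier hα (eventually_degree_eq p j.val) (u i))
    (fun j i => tendsto_scaledCharlierDeriv hα (eventually_degree_eq p j.val) (u i))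
    fun j => tendsto_scaledCharlierDeriv hα (eventually_degree_eq p j.val) x

/-! ### Non-vanishing of the limit determinant -/

/-- The product is a falling factorial of length `N` at each node. -/
lemma eval_nodePoly_prod (hZ : ∀ (i : Fin k) (m : ℤ), u i ≠ m) (N : ℕ) :
    ∏ n ∈ Finset.range N, (nodePoly fun i => u i + N).eval (n : ℝ)
      = (∏ i, Real.Gamma (u i + N + 1)) ^ 2 * (∏ i, 1 / Real.Gamma (u i + 1)) ^ 2 := by
  simp only [eval_nodePoly]
  rw [Finset.prod_comm, ← mul_pow, ← Finset.prod_mul_distrib, ← Finset.prod_pow]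
  refine Finset.prod_congr rfl fun i _ => ?_
  have h := eval_descPochhammer (Gamma_node_ne_zero hZ N i) N
  rw [add_sub_cancel_right] at h
  rw [← h, descPochhammer_eval_eq_prod_range, ← Finset.prod_pow]
  exact Finset.prod_congr rfl fun n _ => by ring

/-- The bound behind `C_k ≠ 0`: the ground state has probability `e^{-α}` in the undeformed
ensemble, uniformly in `N`. -/
lemma le_abs_scaledMinor (hα : 0 < α) (hu : Function.Injective u)
    (hZ : ∀ (i : Fin k) (m : ℤ), u i ≠ m) {N : ℕ} (hN : 0 < N) :
    |confluentDet (fun (j : Fin (2 * k)) i => (X ^ j.val : Polynomial ℝ).eval (u i))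
        (fun j i => (X ^ j.val : Polynomial ℝ).derivative.eval (u i))|
      * (Real.exp (-α) * (∏ i, 1 / Real.Gamma (u i + 1)) ^ 2) ≤ |scaledMinor α u N N| := by
  have ha : 0 < α / N := by positivity
  have hN' : (N : ℝ) ≠ 0 := by positivity
  have hv : Function.Injective fun i => u i + (N : ℝ) := fun i j h => hu (add_right_cancel h)
  have h := (admissibleWeight_charlierWeight ha).le_abs_opMinor hv (node_ne_natCast hZ N) N
  have h0 : opMinor (charlierWeight (α / N)) (fun i => u i + N) (fun j => j.val)
      = confluentDet (fun (j : Fin (2 * k)) i => (X ^ j.val : Polynomial ℝ).eval (u i))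
        (fun j i => (X ^ j.val : Polynomial ℝ).derivative.eval (u i)) :=
    confluentDet_monic_translate u N _ (AdmissibleWeight.monicOrthPoly_monic _)
      (AdmissibleWeight.natDegree_monicOrthPoly _)
  have hfac : ∏ n ∈ Finset.range N, (n.factorial : ℝ) ^ 2 * charlierWeight (α / N) n
        * (nodePoly fun i => u i + N).eval (n : ℝ)
          / pairing (charlierWeight (α / N)) (monicOrthPoly (charlierWeight (α / N)) n)
            (monicOrthPoly (charlierWeight (α / N)) n)
      = Real.exp (-α) * ((∏ i, Real.Gamma (u i + N + 1)) ^ 2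
        * (∏ i, 1 / Real.Gamma (u i + 1)) ^ 2) := by
    rw [← eval_nodePoly_prod hZ]
    have hexp : Real.exp (-α) = ∏ n ∈ Finset.range N, Real.exp (-(α / N)) := by
      rw [Finset.prod_const, Finset.card_range, ← Real.exp_nat_mul]
      congr 1
      field_simp
    rw [hexp, ← Finset.prod_mul_distrib]
    refine Finset.prod_congr rfl fun n _ => ?_
    rw [pairing_charlierWeight ha, charlierWeight_natCast]
    have h1 : (n.factorial : ℝ) ≠ 0 := by exact_mod_cast n.factorial_ne_zero
    have h2 : (α / N) ^ n ≠ 0 := pow_ne_zero _ ha.ne'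
    generalize (α / N) ^ n = b at h2
    field_simp
  rw [h0, hfac, opMinor_charlierWeight hα hZ hN, abs_mul,
    abs_of_nonneg (sq_nonneg (∏ i, Real.Gamma (u i + N + 1)))] at h
  have hpos : 0 < (∏ i, Real.Gamma (u i + N + 1)) ^ 2 := by
    have := Finset.prod_ne_zero_iff.2 fun i (_ : i ∈ Finset.univ) => Gamma_node_ne_zero hZ N i
    positivity
  refine le_of_mul_le_mul_left (le_trans (le_of_eq ?_) h) hpos
  ring

lemma limitMinor_ne_zero (hα : 0 < α) (hu : Function.Injective u)
    (hZ : ∀ (i : Fin k) (m : ℤ), u i ≠ m) : limitMinor α u ≠ 0 := by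
  have hV : confluentDet (fun (j : Fin (2 * k)) i => (X ^ j.val : Polynomial ℝ).eval (u i))
        (fun j i => (X ^ j.val : Polynomial ℝ).derivative.eval (u i)) ≠ 0 := by
    have h := (admissibleWeight_charlierWeight one_pos).opMinor_ne_zero hu
      (fun i n => hZ i n) 0
    have h0 := confluentDet_monic_translate u 0 _
      (AdmissibleWeight.monicOrthPoly_monic (charlierWeight 1))
      (AdmissibleWeight.natDegree_monicOrthPoly (charlierWeight 1))
    simp only [add_zero] at h0
    simp only [zero_add] at h
    rw [← h0]
    exact h
  have hΓ : ∏ i, 1 / Real.Gamma (u i + 1) ≠ 0 := Finset.prod_ne_zero_iff.2 fun i _ => by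
    have := Gamma_node_ne_zero hZ 0 i
    rw [Nat.cast_zero, add_zero] at this
    exact one_div_ne_zero this
  have h := ge_of_tendsto (tendsto_scaledMinor hα u).abs
    ((eventually_gt_atTop 0).mono fun N hN => le_abs_scaledMinor hα hu hZ hN)
  refine abs_pos.1 (lt_of_lt_of_le ?_ h)
  have := Real.exp_pos (-α)
  positivity

/-! ### The determinants of Bessel functions -/

lemma besselJ_sub {α : ℝ} (hα : 0 < α) (x d : ℝ) :
    besselJ (x + d) (2 * √α)
      = α ^ (d / 2) * (α ^ (x / 2) * gammaSeries (besselCoeff α) (x + d)) := by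
  rw [besselJ_eq hα, add_div, Real.rpow_add hα]
  ring

lemma besselL_sub {α : ℝ} (hα : 0 < α) (x d : ℝ) :
    besselL (x + d) (2 * √α)
      = α ^ (d / 2) * (α ^ (x / 2) * (Real.log α / 2) * gammaSeries (besselCoeff α) (x + d)
        + α ^ (x / 2) * deriv (gammaSeries (besselCoeff α)) (x + d)) := by
  rw [besselL_eq hα, add_div, Real.rpow_add hα]
  ring

lemma wronskianC_eq (hα : 0 < α) (u : Fin k → ℝ) :
    wronskianC α u = (∏ j : Fin (2 * k), α ^ (-(j.val : ℝ) / 2)) * (∏ i, α ^ (u i / 2)) ^ 2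
      * limitMinor α u := by
  change confluentDet (fun (j : Fin (2 * k)) i => besselJ (u i - j.val) (2 * √α))
    (fun j i => besselL (u i - j.val) (2 * √α)) = _
  simp only [sub_eq_add_neg, besselJ_sub hα, besselL_sub hα, limitMinor]
  exact confluentDet_scale _ _ _ _ _

/-- The factor between `wronskianA` and `limitChristoffel`, up to `α^{x/2}`. -/
noncomputable def wronskianFactor (α : ℝ) (u : Fin k → ℝ) (p : ℕ) : ℝ :=
  (∏ j : Fin (2 * k + 1), α ^ (((p : ℝ) - j.val) / 2)) * (∏ i, α ^ (u i / 2)) ^ 2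

/-- In the rows of derivatives in `ν`, the derivative of `α^{ν/2}` contributes a multiple of a row
of values, so it drops out. -/
lemma wronskianA_eq (hα : 0 < α) (u : Fin k → ℝ) (p : ℕ) (x : ℝ) :
    wronskianA α u p x = wronskianFactor α u p * α ^ (x / 2) * limitChristoffel α u p x := by
  change borderedDet (fun (j : Fin (2 * k + 1)) i => besselJ (u i + p - j.val) (2 * √α))
    (fun j i => besselL (u i + p - j.val) (2 * √α))
    (fun j => besselJ (x + p - j.val) (2 * √α)) = _
  simp only [add_sub_assoc, besselJ_sub hα, besselL_sub hα, limitChristoffel, wronskianFactor]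
  exact borderedDet_scale _ _ _ _ _ _ _

lemma deriv_wronskianA (hα : 0 < α) (u : Fin k → ℝ) (p : ℕ) (x : ℝ) :
    deriv (wronskianA α u p) x = wronskianFactor α u p * α ^ (x / 2)
      * (Real.log α / 2 * limitChristoffel α u p x + limitChristoffelDeriv α u p x) := by
  have h2 : HasDerivAt (limitChristoffel α u p) (limitChristoffelDeriv α u p x) x := by
    refine hasDerivAt_borderedDet _ _ fun j => ?_
    exact ((differentiable_gammaSeries (summable_besselCoeff α)
      (x + p - j.val)).hasDerivAt.comp_sub_const (x + p) j.val).comp_add_const x p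
  have h3 : wronskianA α u p = fun y => wronskianFactor α u p * (α ^ (y / 2)
      * limitChristoffel α u p y) := by
    funext y
    rw [wronskianA_eq hα, mul_assoc]
  rw [h3]
  exact (((hasDerivAt_rpow_half hα x).mul h2).const_mul _).deriv.trans (by ring)

/-- The powers of `α` in the limit kernel. -/
lemma factor_eq (hα : 0 < α) (u : Fin k → ℝ) :
    α ^ ((2 * k + 1 : ℝ) / 2) * (wronskianFactor α u 0 * wronskianFactor α u 1)
      = α * ((∏ j : Fin (2 * k), α ^ (-(j.val : ℝ) / 2)) * (∏ i, α ^ (u i / 2)) ^ 2) ^ 2 := by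
  have h0 : (∏ j : Fin (2 * k + 1), α ^ ((((0 : ℕ) : ℝ) - j.val) / 2))
      = (∏ j : Fin (2 * k), α ^ (-(j.val : ℝ) / 2)) * (α ^ (k : ℝ))⁻¹ := by
    rw [Fin.prod_univ_castSucc, ← Real.rpow_neg hα.le]
    congr 1
    · simp
    · congr 1
      simp
      ring
  have h1 : (∏ j : Fin (2 * k + 1), α ^ ((((1 : ℕ) : ℝ) - j.val) / 2))
      = α ^ ((2 * k + 1 : ℝ) / 2) * ∏ j : Fin (2 * k + 1), α ^ ((((0 : ℕ) : ℝ) - j.val) / 2) := by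
    have h2 : α ^ ((2 * k + 1 : ℝ) / 2) = ∏ _j : Fin (2 * k + 1), α ^ ((1 : ℝ) / 2) := by
      rw [Finset.prod_const, Finset.card_univ, Fintype.card_fin, ← Real.rpow_mul_natCast hα.le]
      congr 1
      push_cast
      ring
    rw [h2, ← Finset.prod_mul_distrib]
    refine Finset.prod_congr rfl fun j _ => ?_
    rw [← Real.rpow_add hα]
    congr 1
    push_cast
    ring
  have h3 : α ^ ((2 * k + 1 : ℝ) / 2) * α ^ ((2 * k + 1 : ℝ) / 2)
      = α * α ^ (k : ℝ) * α ^ (k : ℝ) := by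
    rw [← Real.rpow_add hα, mul_assoc, ← Real.rpow_add hα]
    nth_rewrite 2 [← Real.rpow_one α]
    rw [← Real.rpow_add hα]
    congr 1
    ring
  have h4 : α ^ (k : ℝ) ≠ 0 := (Real.rpow_pos_of_pos hα _).ne'
  rw [wronskianFactor, wronskianFactor, h1, h0]
  generalize ∏ j : Fin (2 * k), α ^ (-(j.val : ℝ) / 2) = T
  generalize (∏ i, α ^ (u i / 2)) ^ 2 = S
  calc _ = (α ^ ((2 * k + 1 : ℝ) / 2) * α ^ ((2 * k + 1 : ℝ) / 2))
        * (α ^ (k : ℝ))⁻¹ * (α ^ (k : ℝ))⁻¹ * (T * S) ^ 2 := by ring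
    _ = _ := by
      rw [h3]
      field_simp

/-! ### The limit of the kernel -/

/-- The normalisation of the Charlier weight against `h_{N-1} = (α/N)^{N-1} (N-1)!`; one Gamma
factor cancels the denominator of the weight, and the other one is asymptotic to `N! N^x`. -/
lemma tendsto_charlierWeight_mul_Gamma (hα : 0 < α) (x : ℝ) :
    Tendsto (fun N : ℕ => charlierWeight (α / N) (x + N) * Real.Gamma (x + N + 1) ^ 2
      / ((α / N) ^ (N - 1) * (N - 1).factorial)) atTop (𝓝 (α ^ (x + 1))) := by
  have h1 : Tendsto (fun N : ℕ => Real.exp (-(α / N))) atTop (𝓝 1) := by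
    have h := (tendsto_const_div_atTop_nhds_zero_nat α).neg
    rw [neg_zero] at h
    have h' := (Real.continuous_exp.tendsto 0).comp h
    rw [Real.exp_zero] at h'
    exact h'
  have h2 := (h1.mul (tendsto_Gamma_div x)).const_mul (α ^ (x + 1))
  rw [mul_one, mul_one] at h2
  refine h2.congr' ?_
  filter_upwards [eventually_gt_atTop 0,
    (tendsto_natCast_atTop_atTop.eventually_gt_atTop (-x - 1))] with N hN hNx
  obtain ⟨M, rfl⟩ : ∃ M, N = M + 1 := ⟨N - 1, by omega⟩
  have hN' : (0 : ℝ) < ((M + 1 : ℕ) : ℝ) := by positivity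
  have hΓ : Real.Gamma (x + ((M + 1 : ℕ) : ℝ) + 1) ≠ 0 :=
    (Real.Gamma_pos_of_pos (by linarith)).ne'
  have ha : 0 < α / ((M + 1 : ℕ) : ℝ) := by positivity
  have hpow : (α / ((M + 1 : ℕ) : ℝ)) ^ (x + ((M + 1 : ℕ) : ℝ))
      = α ^ (x + 1) / (((M + 1 : ℕ) : ℝ) ^ x * ((M + 1 : ℕ) : ℝ))
        * (α / ((M + 1 : ℕ) : ℝ)) ^ M := by
    rw [← Real.rpow_natCast _ M, show x + ((M + 1 : ℕ) : ℝ) = x + 1 + (M : ℝ) by push_cast; ring,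
      Real.rpow_add ha, Real.div_rpow hα.le hN'.le, Real.rpow_add_one hN'.ne']
  have h3 : (α / ((M + 1 : ℕ) : ℝ)) ^ M ≠ 0 := (pow_pos ha M).ne'
  have h4 : ((M + 1 : ℕ) : ℝ) ^ x ≠ 0 := (Real.rpow_pos_of_pos hN' x).ne'
  have h5 : (M.factorial : ℝ) ≠ 0 := by exact_mod_cast M.factorial_ne_zero
  rw [charlierWeight, hpow, Nat.add_sub_cancel, Nat.factorial_succ, Nat.cast_mul]
  generalize (α / ((M + 1 : ℕ) : ℝ)) ^ M = b at h3
  field_simp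

lemma eventually_Gamma_pos (x : ℝ) : ∀ᶠ N : ℕ in atTop, 0 < Real.Gamma (x + N + 1) := by
  filter_upwards [(tendsto_natCast_atTop_atTop.eventually_gt_atTop (-x - 1))] with N hN
  exact Real.Gamma_pos_of_pos (by linarith)

/-- The prefactor of the kernel. It needs `N` so large that both Gamma factors are positive, as a
square root of their squares occurs. -/
lemma tendsto_sqrt_charlierWeight (hα : 0 < α) (x y : ℝ) :
    Tendsto (fun N : ℕ => √(charlierWeight (α / N) (x + N) * charlierWeight (α / N) (y + N))
      * (Real.Gamma (x + N + 1) * Real.Gamma (y + N + 1))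
        / ((α / N) ^ (N - 1) * (N - 1).factorial)) atTop (𝓝 (α * (α ^ (x / 2) * α ^ (y / 2)))) := by
  have h := ((tendsto_charlierWeight_mul_Gamma hα x).mul
    (tendsto_charlierWeight_mul_Gamma hα y)).sqrt
  have hlim : √(α ^ (x + 1) * α ^ (y + 1)) = α * (α ^ (x / 2) * α ^ (y / 2)) := by
    have hhalf : ∀ z : ℝ, α ^ (z + 1) = α ^ (z / 2) * α ^ (z / 2) * α := fun z => by
      rw [← Real.rpow_add hα, add_halves, Real.rpow_add_one hα.ne']
    rw [hhalf, hhalf, show α ^ (x / 2) * α ^ (x / 2) * α * (α ^ (y / 2) * α ^ (y / 2) * α)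
      = (α * (α ^ (x / 2) * α ^ (y / 2))) ^ 2 by ring]
    exact Real.sqrt_sq (by positivity)
  rw [hlim] at h
  refine h.congr' ?_
  filter_upwards [eventually_Gamma_pos x, eventually_Gamma_pos y, eventually_gt_atTop 0]
    with N hx hy hN
  have hh : 0 < (α / N) ^ (N - 1) * ((N - 1).factorial : ℝ) := by positivity
  rw [show ∀ a b c d e : ℝ, a * c ^ 2 / e * (b * d ^ 2 / e) = a * b * (c * d / e) ^ 2 from
    fun a b c d e => by ring, Real.sqrt_mul' _ (sq_nonneg _),
    Real.sqrt_sq (div_nonneg (mul_pos hx hy).le hh.le), mul_div_assoc']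

lemma tendsto_cdKernel (hα : 0 < α) (hu : Function.Injective u)
    (hZ : ∀ (i : Fin k) (m : ℤ), u i ≠ m) {x y : ℝ} (hxy : x ≠ y) (hx : ∀ i, x ≠ u i)
    (hy : ∀ i, y ≠ u i) :
    Tendsto (fun N : ℕ => cdKernel (deformedWeight α u N) N (x + N) (y + N)) atTop
      (𝓝 (limitKernel α u x y)) := by
  have hC := limitMinor_ne_zero hα hu hZ
  have h0 := tendsto_scaledChristoffel hα u 0
  have h1 := tendsto_scaledChristoffel hα u 1
  have hP : ∏ i, |(x - u i) * (y - u i)| ≠ 0 := Finset.prod_ne_zero_iff.2 fun i _ =>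
    abs_ne_zero.2 (mul_ne_zero (sub_ne_zero.2 (hx i)) (sub_ne_zero.2 (hy i)))
  have hlim := ((tendsto_sqrt_charlierWeight hα x y).div
    (((tendsto_scaledMinor hα u).pow 2).mul_const (∏ i, |(x - u i) * (y - u i)|))
    (mul_ne_zero (pow_ne_zero 2 hC) hP)).mul
    ((((h0 x).mul (h1 y)).sub ((h1 x).mul (h0 y))).div_const (x - y))
  have hval : limitKernel α u x y = α * (α ^ (x / 2) * α ^ (y / 2))
      / (limitMinor α u ^ 2 * ∏ i, |(x - u i) * (y - u i)|)
      * ((limitChristoffel α u 0 x * limitChristoffel α u 1 y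
        - limitChristoffel α u 1 x * limitChristoffel α u 0 y) / (x - y)) := by
    have hf := factor_eq hα u
    have hF : (∏ j : Fin (2 * k), α ^ (-(j.val : ℝ) / 2)) * (∏ i, α ^ (u i / 2)) ^ 2 ≠ 0 := by
      positivity
    rw [limitKernel, wronskianC_eq hα]
    simp only [wronskianA_eq hα]
    generalize (∏ j : Fin (2 * k), α ^ (-(j.val : ℝ) / 2)) * (∏ i, α ^ (u i / 2)) ^ 2 = F at hf hF
    have hxy' := sub_ne_zero.2 hxy
    field_simp
    linear_combination (limitChristoffel α u 0 x * limitChristoffel α u 1 y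
        - limitChristoffel α u 1 x * limitChristoffel α u 0 y) * hf
  rw [hval]
  refine hlim.congr' ?_
  filter_upwards [eventually_Gamma_pos x, eventually_Gamma_pos y, eventually_gt_atTop 0]
    with N hΓx hΓy hN
  obtain ⟨M, rfl⟩ : ∃ M, N = M + 1 := ⟨N - 1, by omega⟩
  have ha : 0 < α / ((M + 1 : ℕ) : ℝ) := by positivity
  have hw := admissibleWeight_charlierWeight ha
  have hW := hw.opMinor_ne_zero (v := fun i => u i + ((M + 1 : ℕ) : ℝ))
    (fun i j h => hu (add_right_cancel h)) (node_ne_natCast hZ (M + 1)) (M + 1)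
  rw [opMinor_charlierWeight hα hZ hN] at hW
  rw [deformedWeight, hw.cdKernel_christoffelWeight (fun i j h => hu (add_right_cancel h))
    (node_ne_natCast hZ (M + 1)) M (fun h => hxy (add_right_cancel h))
    (fun i h => hx i (add_right_cancel h)) (fun i h => hy i (add_right_cancel h)),
    opMinor_charlierWeight hα hZ hN, eval_christoffelPoly_charlierWeight hα hZ hN _ hΓx.ne',
    eval_christoffelPoly_charlierWeight hα hZ hN _ hΓx.ne',
    eval_christoffelPoly_charlierWeight hα hZ hN _ hΓy.ne',
    eval_christoffelPoly_charlierWeight hα hZ hN _ hΓy.ne', pairing_charlierWeight ha]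
  simp only [add_sub_add_right_eq_sub, Nat.sub_zero, Nat.add_sub_cancel, Pi.div_apply]
  have hS := left_ne_zero_of_mul hW
  have hc := right_ne_zero_of_mul hW
  have hh : (α / ((M + 1 : ℕ) : ℝ)) ^ M * (M.factorial : ℝ) ≠ 0 := by positivity
  have hxy' := sub_ne_zero.2 hxy
  generalize (∏ i, Real.Gamma (u i + ((M + 1 : ℕ) : ℝ) + 1)) ^ 2 = S at hS
  generalize (α / ((M + 1 : ℕ) : ℝ)) ^ M * (M.factorial : ℝ) = h at hh
  field_simp

lemma tendsto_cdKernel_diag (hα : 0 < α) (hu : Function.Injective u)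
    (hZ : ∀ (i : Fin k) (m : ℤ), u i ≠ m) {x : ℝ} (hx : ∀ i, x ≠ u i) :
    Tendsto (fun N : ℕ => cdKernel (deformedWeight α u N) N (x + N) (x + N)) atTop
      (𝓝 (limitKernelDiag α u x)) := by
  have hC := limitMinor_ne_zero hα hu hZ
  have h0 := tendsto_scaledChristoffel hα u 0 x
  have h1 := tendsto_scaledChristoffel hα u 1 x
  have h0' := tendsto_scaledChristoffelDeriv hα u 0 x
  have h1' := tendsto_scaledChristoffelDeriv hα u 1 x
  have hP : ∏ i, (x - u i) ^ 2 ≠ 0 := Finset.prod_ne_zero_iff.2 fun i _ =>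
    pow_ne_zero 2 (sub_ne_zero.2 (hx i))
  have hlim := ((tendsto_sqrt_charlierWeight hα x x).div
    (((tendsto_scaledMinor hα u).pow 2).mul_const (∏ i, (x - u i) ^ 2))
    (mul_ne_zero (pow_ne_zero 2 hC) hP)).mul ((h0'.mul h1).sub (h1'.mul h0))
  have hval : limitKernelDiag α u x = α * (α ^ (x / 2) * α ^ (x / 2))
      / (limitMinor α u ^ 2 * ∏ i, (x - u i) ^ 2)
      * (limitChristoffelDeriv α u 0 x * limitChristoffel α u 1 x
        - limitChristoffelDeriv α u 1 x * limitChristoffel α u 0 x) := by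
    have hf := factor_eq hα u
    have hF : (∏ j : Fin (2 * k), α ^ (-(j.val : ℝ) / 2)) * (∏ i, α ^ (u i / 2)) ^ 2 ≠ 0 := by
      positivity
    rw [limitKernelDiag, wronskianC_eq hα]
    simp only [wronskianA_eq hα, deriv_wronskianA hα]
    generalize (∏ j : Fin (2 * k), α ^ (-(j.val : ℝ) / 2)) * (∏ i, α ^ (u i / 2)) ^ 2 = F at hf hF
    field_simp
    linear_combination 2 * (limitChristoffelDeriv α u 0 x * limitChristoffel α u 1 x
        - limitChristoffelDeriv α u 1 x * limitChristoffel α u 0 x) * hf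
  rw [hval]
  refine hlim.congr' ?_
  filter_upwards [eventually_Gamma_pos x, eventually_gt_atTop 0] with N hΓx hN
  obtain ⟨M, rfl⟩ : ∃ M, N = M + 1 := ⟨N - 1, by omega⟩
  have ha : 0 < α / ((M + 1 : ℕ) : ℝ) := by positivity
  have hw := admissibleWeight_charlierWeight ha
  have hW := hw.opMinor_ne_zero (v := fun i => u i + ((M + 1 : ℕ) : ℝ))
    (fun i j h => hu (add_right_cancel h)) (node_ne_natCast hZ (M + 1)) (M + 1)
  rw [opMinor_charlierWeight hα hZ hN] at hW
  rw [deformedWeight, hw.cdKernel_christoffelWeight_diag (fun i j h => hu (add_right_cancel h))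
    (node_ne_natCast hZ (M + 1)) M (fun i h => hx i (add_right_cancel h)),
    opMinor_charlierWeight hα hZ hN, eval_christoffelPoly_charlierWeight hα hZ hN _ hΓx.ne',
    eval_christoffelPoly_charlierWeight hα hZ hN _ hΓx.ne',
    eval_derivative_christoffelPoly_charlierWeight hα hZ hN _ hΓx.ne',
    eval_derivative_christoffelPoly_charlierWeight hα hZ hN _ hΓx.ne', pairing_charlierWeight ha]
  simp only [add_sub_add_right_eq_sub, Nat.sub_zero, Nat.add_sub_cancel, Pi.div_apply]
  have hS := left_ne_zero_of_mul hW
  have hc := right_ne_zero_of_mul hW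
  have hh : (α / ((M + 1 : ℕ) : ℝ)) ^ M * (M.factorial : ℝ) ≠ 0 := by positivity
  generalize (∏ i, Real.Gamma (u i + ((M + 1 : ℕ) : ℝ) + 1)) ^ 2 = S at hS
  generalize (α / ((M + 1 : ℕ) : ℝ)) ^ M * (M.factorial : ℝ) = h at hh
  field_simp
  ring

/-- Without nodes, `C_0 = 1` and `A_{0,p}(x) = J_{x+p}(2√α)`. -/
lemma limitKernel_zero (α : ℝ) (u : Fin 0 → ℝ) (x y : ℝ) :
    limitKernel α u x y = discreteBesselKernel α x y := by
  have hA : ∀ (p : ℕ) (x : ℝ), wronskianA α u p x = besselJ (x + p) (2 * √α) := by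
    intro p x
    refine (Matrix.det_fin_one _).trans ?_
    simp
  have hC : wronskianC α u = 1 := Matrix.det_fin_zero
  rw [limitKernel, discreteBesselKernel, hC]
  simp [hA, Real.sqrt_eq_rpow]

theorem theorem3p1 (α : ℝ) (hα : 0 < α) (k : ℕ) (u : Fin k → ℝ)
    (hu : Function.Injective u) (hZ : ∀ (i : Fin k) (m : ℤ), u i ≠ m) :
    -- `K_N` is the correlation kernel of the deformed Charlier ensemble
    (∀ N : ℕ, 1 ≤ N →
      IsDeterminantalWithKernel (opeProcess (deformedWeight α u N) N)
        (fun a b : ℕ => cdKernel (deformedWeight α u N) N a b)) ∧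
    -- the limit kernel is well defined
    Differentiable ℝ (fun ν : ℝ => besselJ ν (2 * √α)) ∧
    wronskianC α u ≠ 0 ∧
    -- limit off the diagonal
    (∀ x y : ℝ, x ≠ y → (∀ i, x ≠ u i) → (∀ i, y ≠ u i) →
      Tendsto (fun N : ℕ => cdKernel (deformedWeight α u N) N (x + N) (y + N)) atTop
        (𝓝 (limitKernel α u x y))) ∧
    -- limit on the diagonal
    (∀ x : ℝ, (∀ i, x ≠ u i) →
      Tendsto (fun N : ℕ => cdKernel (deformedWeight α u N) N (x + N) (x + N)) atTop
        (𝓝 (limitKernelDiag α u x))) ∧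
    -- without deformation the limit is the discrete Bessel kernel
    (k = 0 → ∀ x y : ℝ, x ≠ y → limitKernel α u x y = discreteBesselKernel α x y) := by
  refine ⟨fun N hN => ?_, fun ν => (hasDerivAt_besselJ hα ν).differentiableAt, ?_,
    fun x y hxy hx hy => tendsto_cdKernel hα hu hZ hxy hx hy,
    fun x hx => tendsto_cdKernel_diag hα hu hZ hx, ?_⟩
  · have ha : 0 < α / N := div_pos hα (by exact_mod_cast hN)
    exact ((admissibleWeight_charlierWeight ha).christoffel
      (node_ne_natCast hZ N)).isDeterminantalWithKernel_ope N
  · rw [wronskianC_eq hα]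
    exact mul_ne_zero (by positivity) (limitMinor_ne_zero hα hu hZ)
  · rintro rfl x y -
    exact limitKernel_zero α u x y
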